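/- Let $\mathcal P_\lambda$ be a homogeneous Poisson point process on $\mathbb R^2$ with intensity $\lambda>0$, and let $0<\theta<\pi/2$. For $v\in\mathbb R^2$ let $\mathcal C_\theta(v)$ be the set of points $v+(r\cos\varphi,r\sin\varphi)$ with $r>0$ and $|\varphi|\le\theta$. Put $V_0=o$ (the origin) and let, for $n\ge1$, $V_n$ be the (almost surely unique) point of $\mathcal P_\lambda\cap\mathcal C_\theta(V_{n-1})$ that is closest to $V_{n-1}$ in the Euclidean distance, and $U_n=V_n-V_{n-1}$. Define the history sets by $H_0=\emptyset$ and $$H_n=\mathcal C_\theta(V_n)\cap\big(H_{n-1}\cup B(V_{n-1},|U_n|)\big),\qquad n\ge1,$$ where $B(x,r)$ is the open ball with centre $x$ and radius $r$, and let $\tau_0=0$ and $\tau_k=\inf\{n>\tau_{k-1}\colon H_n=\emptyset\}$ for $k\ge1$ (with $\inf\emptyset=\infty$). Then the $\tau_k$ are almost surely finite, the gaps $(\tau_k-\tau_{k-1})_{k\ge1}$ are independent and identically distributed, and there are constants $c,C>0$ that depend only on $\theta$ (in particular not on $\lambda$, $k$ or $n$) such that, for all integers $k\ge1$ and $n\ge0$,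 $$\mathbb P(\tau_k-\tau_{k-1}\ge n)\le C e^{-cn}\qquad\text{and}\qquad \mathbb P(\tau_k\ge n)\le kCe^{-cn/k}.$$ -/

import Mathlib

open MeasureTheory ProbabilityTheory
open scoped NNReal ENNReal

namespace DirectedNavigation

/-- `P` is a homogeneous Poisson point process with intensity `lam` on the Euclidean plane, seen as
a random set of points; the plane `ℝ²` is identified with `ℂ`, whose norm is the Euclidean norm and
whose `volume` is the Lebesgue measure. The number of points in a Borel set is a random variable
with values in `ℕ∞`, it is Poisson distributed with mean `lam * area` if the area is finite, and the
numbers of points in disjoint Borel sets are independent. -/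
structure IsPoissonProcess {Ω : Type*} [MeasurableSpace Ω] (μ : Measure Ω) (lam : ℝ≥0)
    (P : Ω → Set ℂ) : Prop where
  measurable_count : ∀ B : Set ℂ, MeasurableSet B → Measurable fun ω => (P ω ∩ B).encard
  map_count : ∀ B : Set ℂ, MeasurableSet B → volume B ≠ ∞ →
    μ.map (fun ω => (P ω ∩ B).encard) =
      (poissonMeasure (lam * (volume B).toNNReal)).map (fun n : ℕ => (n : ℕ∞))
  indep_count : ∀ (m : ℕ) (B : Fin m → Set ℂ), (∀ i, MeasurableSet (B i)) →
    Pairwise (fun i j => Disjoint (B i) (B j)) →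
    iIndepFun (fun (i : Fin m) (ω : Ω) => (P ω ∩ B i).encard) μ

/-- The right-facing cone with apex `v` (the apex itself is excluded): the points `w` such that
`w - v` has polar coordinates `(r, φ)` with `r > 0` and `|φ| ≤ θ`. -/
def cone (θ : ℝ) (v : ℂ) : Set ℂ :=
  {w | 0 < ‖w - v‖ ∧ |Complex.arg (w - v)| ≤ θ}

/-- `w` is a point of the configuration `S` in the cone at `v` that is closest to `v`. -/
def IsSuccessor (θ : ℝ) (S : Set ℂ) (v w : ℂ) : Prop :=
  w ∈ S ∩ cone θ v ∧ ∀ u ∈ S ∩ cone θ v, ‖w - v‖ ≤ ‖u - v‖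

open Classical in
/-- The successor of `v`, the argmin of the distance to `v` over `S ∩ cone θ v`. If there is no
minimizer the value is `v`, and if there are several one of them is chosen; for a Poisson process
and the navigation started at the origin both happen with probability zero only. -/
noncomputable def successor (θ : ℝ) (S : Set ℂ) (v : ℂ) : ℂ :=
  if h : ∃ w, IsSuccessor θ S v w then h.choose else v

/-- The waypoints `V n` of the directed navigation in the configuration `S`, started at the
origin. -/
noncomputable def waypoint (θ : ℝ) (S : Set ℂ) : ℕ → ℂ
  | 0 => 0
  | n + 1 => successor θ S (waypoint θ S n)

/-- The progress variables `U n = V n - V (n - 1)`, for `n ≥ 1`. -/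
noncomputable def progress (θ : ℝ) (S : Set ℂ) (n : ℕ) : ℂ :=
  waypoint θ S n - waypoint θ S (n - 1)

/-- The history sets: `H 0 = ∅`, and `H n` is the part of the cone at `V n` that lies in
`H (n - 1)` or in the open ball around `V (n - 1)` with radius `|U n|`. -/
noncomputable def history (θ : ℝ) (S : Set ℂ) : ℕ → Set ℂ
  | 0 => ∅
  | n + 1 => cone θ (waypoint θ S (n + 1)) ∩
      (history θ S n ∪ Metric.ball (waypoint θ S n) ‖progress θ S (n + 1)‖)

/-- The renewal steps: `τ 0 = 0`, and `τ k` is the first step `n > τ (k - 1)` with `H n = ∅`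
(the infimum of the empty set being `⊤ = ∞`). -/
noncomputable def tau (θ : ℝ) (S : Set ℂ) : ℕ → ℕ∞
  | 0 => 0
  | k + 1 => sInf {t : ℕ∞ | ∃ n : ℕ, t = n ∧ tau θ S k < n ∧ history θ S n = ∅}

/-- The renewal gaps: `gap k = τ (k + 1) - τ k`, for `k ≥ 0`. -/
noncomputable def gap (θ : ℝ) (S : Set ℂ) (k : ℕ) : ℕ∞ :=
  tau θ S (k + 1) - tau θ S k

end DirectedNavigation

namespace DirectedNavigation

/-! ### Cones, explored regions and the narrow cone -/

section Geometry

variable {θ : ℝ}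

/-! What the navigation has learnt about the point process is where its waypoints are and that the
explored regions are void; an explored region is the part of the cone at a waypoint that is closer
than the next waypoint. The cones along the path are nested, so the future depends only on the
points in the current cone, and the history set is the explored part of that cone. When it is empty,
the future is independent of the past and, up to translation, distributed like the whole path.

This is made exact without conditioning. `pathSum` is an iterated sum over the points of the process
which almost surely equals the indicator of a prescribed finite pattern of renewals and non-renewals
(`pathSum_waypoint`). The Mecke equation turns its mean into an iterated Lebesgue integral,
`pathProb` (`lintegral_pathSum`). A renewal splits this integral into a product
(`pathProb_append_true_cons`), which makes the gaps independent and identically distributed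
(`map_renewalGap_eq_pi`). Scaling the plane removes the intensity (`pathProb_scale`), so the
constants depend on θ only.

The tail (`exists_tail_bound`) rests on the narrow cone with slope min(tan θ, cot θ). Steps in the
cone and in the narrow cone never form an obtuse angle, so the history never enters the narrow cone
at the current waypoint. Whatever the history is, there is thus fresh territory ahead: the step
length has a bounded exponential moment, and with a probability bounded below the step goes into the
narrow cone and at least L to the right. If L bounds the horizontal extent of the history, such a
step is a renewal. Otherwise exp L shrinks on average up to an additive constant. Hence A + exp L,
killed at renewals, contracts by a factor ρ < 1 per step.

The bound for τ_k follows by pigeonhole: if τ_k ≥ n, one of the k gaps is at least n/k. -/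

theorem mem_cone_iff (hθ : θ ∈ Set.Ioo 0 (Real.pi / 2)) {v w : ℂ} :
    w ∈ cone θ v ↔ 0 < (w - v).re ∧ |(w - v).im| ≤ Real.tan θ * (w - v).re := by
  obtain ⟨h0, h1⟩ := hθ
  have key : ∀ z : ℂ, 0 < z.re → (|z.arg| ≤ θ ↔ |z.im| ≤ Real.tan θ * z.re) := by
    intro z hz
    have hlt : |z.arg| < Real.pi / 2 := Complex.abs_arg_lt_pi_div_two_iff.2 (Or.inl hz)
    rw [abs_lt] at hlt
    have htan : Real.tan z.arg = z.im / z.re := Complex.tan_arg z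
    have hm := Real.strictMonoOn_tan
    have e1 : z.arg ≤ θ ↔ Real.tan z.arg ≤ Real.tan θ :=
      (hm.le_iff_le ⟨hlt.1, hlt.2⟩ ⟨by linarith, h1⟩).symm
    have e2 : -θ ≤ z.arg ↔ Real.tan (-θ) ≤ Real.tan z.arg :=
      (hm.le_iff_le ⟨by linarith, by linarith⟩ ⟨hlt.1, hlt.2⟩).symm
    rw [abs_le, e1, e2, Real.tan_neg, htan, abs_le, div_le_iff₀ hz, le_div_iff₀ hz, neg_mul]
  simp only [cone, Set.mem_ofPred_eq]
  constructor
  · rintro ⟨hn, ha⟩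
    have hre : 0 < (w - v).re := by
      have : |(w - v).arg| < Real.pi / 2 := ha.trans_lt h1
      rcases Complex.abs_arg_lt_pi_div_two_iff.1 this with h | h
      · exact h
      · rw [h] at hn; simp at hn
    exact ⟨hre, (key _ hre).1 ha⟩
  · rintro ⟨hre, him⟩
    refine ⟨?_, (key _ hre).2 him⟩
    rw [norm_pos_iff]
    intro h
    rw [h] at hre
    simp at hre

theorem tan_pos_of_mem (hθ : θ ∈ Set.Ioo 0 (Real.pi / 2)) : 0 < Real.tan θ :=
  Real.tan_pos_of_pos_of_lt_pi_div_two hθ.1 hθ.2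

/-- As θ < π/2, the cone at the origin is closed under addition. Hence the cones along a path are
nested, and the path only ever sees points of its current cone. -/
theorem cone_subset_cone (hθ : θ ∈ Set.Ioo 0 (Real.pi / 2)) {x y : ℂ} (hy : y ∈ cone θ x) :
    cone θ y ⊆ cone θ x := by
  intro w hw
  rw [mem_cone_iff hθ] at *
  simp only [Complex.sub_re, Complex.sub_im, abs_le] at *
  refine ⟨by linarith, ?_, ?_⟩ <;> nlinarith

theorem notMem_cone_self (θ : ℝ) (x : ℂ) : x ∉ cone θ x := by simp [cone]

theorem measurableSet_cone_prod (hθ : θ ∈ Set.Ioo 0 (Real.pi / 2)) :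
    MeasurableSet {p : ℂ × ℂ | p.2 ∈ cone θ p.1} := by
  simp only [mem_cone_iff hθ, Set.ofPred_and]
  refine MeasurableSet.inter ?_ ?_
  · exact measurableSet_lt measurable_const (by fun_prop)
  · exact measurableSet_le (by fun_prop) (by fun_prop)

theorem measurableSet_cone (hθ : θ ∈ Set.Ioo 0 (Real.pi / 2)) (x : ℂ) :
    MeasurableSet (cone θ x) :=
  measurable_prodMk_left (x := x) (measurableSet_cone_prod hθ)

/-- The part of the cone at `x` that is closer to `x` than `y`. -/
def explored (θ : ℝ) (x y : ℂ) : Set ℂ := cone θ x ∩ Metric.ball x ‖y - x‖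

theorem notMem_explored_self (θ : ℝ) (x y : ℂ) : y ∉ explored θ x y := by
  simp [explored, dist_eq_norm]

theorem measurableSet_explored_prod (hθ : θ ∈ Set.Ioo 0 (Real.pi / 2)) :
    MeasurableSet {p : (ℂ × ℂ) × ℂ | p.2 ∈ explored θ p.1.1 p.1.2} := by
  have h1 : MeasurableSet {p : (ℂ × ℂ) × ℂ | p.2 ∈ cone θ p.1.1} :=
    (measurableSet_cone_prod hθ).preimage (f := fun p : (ℂ × ℂ) × ℂ => (p.1.1, p.2)) (by fun_prop)
  refine h1.inter (s₂ := {p : (ℂ × ℂ) × ℂ | dist p.2 p.1.1 < ‖p.1.2 - p.1.1‖}) ?_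
  exact measurableSet_lt (by fun_prop) (by fun_prop)

theorem measurableSet_explored (hθ : θ ∈ Set.Ioo 0 (Real.pi / 2)) (x y : ℂ) :
    MeasurableSet (explored θ x y) :=
  (measurableSet_cone hθ x).inter measurableSet_ball

theorem volume_explored_ne_top (θ : ℝ) (x y : ℂ) : volume (explored θ x y) ≠ ∞ :=
  ((measure_mono Set.inter_subset_right).trans_lt measure_ball_lt_top).ne

/-- An open ball that meets the cone at `y` meets it in positive area. -/
theorem volume_cone_inter_ball_pos (hθ : θ ∈ Set.Ioo 0 (Real.pi / 2)) {y c w : ℂ} {r : ℝ}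
    (hw : w ∈ cone θ y) (hwr : w ∈ Metric.ball c r) :
    0 < volume (cone θ y ∩ Metric.ball c r) := by
  have hm := tan_pos_of_mem hθ
  set U : Set ℂ := {z | 0 < (z - y).re ∧ |(z - y).im| < Real.tan θ * (z - y).re} with hU
  have hUo : IsOpen U := by
    rw [hU, Set.ofPred_and]
    refine IsOpen.inter ?_ ?_
    · exact isOpen_lt continuous_const (by fun_prop)
    · exact isOpen_lt (by fun_prop) (by fun_prop)
  have hUs : U ⊆ cone θ y := fun z hz => (mem_cone_iff hθ).2 ⟨hz.1, hz.2.le⟩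
  have hne : (U ∩ Metric.ball c r).Nonempty := by
    rw [Metric.mem_ball, dist_eq_norm] at hwr
    rw [mem_cone_iff hθ] at hw
    set e : ℝ := (r - ‖w - c‖) / 2 with he
    have hepos : 0 < e := by rw [he]; linarith
    -- A shift to the right moves a boundary point of the cone into its interior, and half the
    -- distance to the sphere keeps it in the ball.
    refine ⟨w + (e : ℂ), ⟨?_, ?_⟩, ?_⟩
    · have := hw.1
      simp only [Complex.sub_re, Complex.add_re, Complex.ofReal_re] at *
      linarith
    · have h1 := hw.2
      have : 0 < Real.tan θ * e := mul_pos hm hepos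
      simp only [Complex.sub_re, Complex.sub_im, Complex.add_re, Complex.add_im,
        Complex.ofReal_re, Complex.ofReal_im, add_zero] at *
      linarith
    · rw [Metric.mem_ball, dist_eq_norm]
      calc ‖w + (e : ℂ) - c‖ = ‖(w - c) + (e : ℂ)‖ := by ring_nf
        _ ≤ ‖w - c‖ + ‖(e : ℂ)‖ := norm_add_le _ _
        _ = ‖w - c‖ + e := by rw [Complex.norm_real, Real.norm_of_nonneg hepos.le]
        _ < r := by rw [he]; linarith
  exact ((hUo.inter Metric.isOpen_ball).measure_pos volume hne).trans_le
    (measure_mono (Set.inter_subset_inter_left _ hUs))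

/-- The slope of the narrow cone, which the history sets never meet. -/
noncomputable def narrowSlope (θ : ℝ) : ℝ := min (Real.tan θ) (Real.tan θ)⁻¹

/-- The cone at `x` with the slope `narrowSlope θ`. -/
def narrowCone (θ : ℝ) (x : ℂ) : Set ℂ :=
  {w | 0 < (w - x).re ∧ |(w - x).im| ≤ narrowSlope θ * (w - x).re}

theorem narrowSlope_pos (hθ : θ ∈ Set.Ioo 0 (Real.pi / 2)) : 0 < narrowSlope θ :=
  lt_min (tan_pos_of_mem hθ) (inv_pos.2 (tan_pos_of_mem hθ))

theorem narrowCone_subset_cone (hθ : θ ∈ Set.Ioo 0 (Real.pi / 2)) (x : ℂ) :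
    narrowCone θ x ⊆ cone θ x := fun _ hw =>
  (mem_cone_iff hθ).2 ⟨hw.1, hw.2.trans (mul_le_mul_of_nonneg_right (min_le_left _ _) hw.1.le)⟩

theorem measurableSet_narrowCone (θ : ℝ) (x : ℂ) : MeasurableSet (narrowCone θ x) := by
  rw [narrowCone, Set.ofPred_and]
  refine MeasurableSet.inter ?_ ?_
  · exact measurableSet_lt measurable_const (by fun_prop)
  · exact measurableSet_le (by fun_prop) (by fun_prop)

/-- Steps in the cone and in the narrow cone do not make an obtuse angle. -/
theorem norm_sub_le_of_cone_narrowCone (hθ : θ ∈ Set.Ioo 0 (Real.pi / 2)) {a b d : ℂ}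
    (h : (b ∈ cone θ a ∧ d ∈ narrowCone θ b) ∨ (b ∈ narrowCone θ a ∧ d ∈ cone θ b)) :
    ‖b - a‖ ≤ ‖d - a‖ := by
  have hm := tan_pos_of_mem hθ
  -- That the product of the two slopes is at most 1 is exactly what makes the inner product of two
  -- steps nonnegative.
  have hmm : Real.tan θ * narrowSlope θ ≤ 1 := by
    calc Real.tan θ * narrowSlope θ ≤ Real.tan θ * (Real.tan θ)⁻¹ :=
          mul_le_mul_of_nonneg_left (min_le_right _ _) hm.le
      _ = 1 := mul_inv_cancel₀ hm.ne'
  have inner_nonneg : ∀ z w : ℂ, 0 < z.re → 0 < w.re → |z.im| ≤ Real.tan θ * z.re →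
      |w.im| ≤ narrowSlope θ * w.re → 0 ≤ z.re * w.re + z.im * w.im := by
    intro z w hz hw hz' hw'
    have h1 : |z.im * w.im| ≤ z.re * w.re := by
      rw [abs_mul]
      calc |z.im| * |w.im| ≤ (Real.tan θ * z.re) * (narrowSlope θ * w.re) :=
            mul_le_mul hz' hw' (abs_nonneg _) (by positivity)
        _ = (Real.tan θ * narrowSlope θ) * (z.re * w.re) := by ring
        _ ≤ 1 * (z.re * w.re) := mul_le_mul_of_nonneg_right hmm (by positivity)
        _ = _ := one_mul _
    linarith [neg_abs_le (z.im * w.im)]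
  have hin : 0 ≤ (b - a).re * (d - b).re + (b - a).im * (d - b).im := by
    rcases h with ⟨h1, h2⟩ | ⟨h1, h2⟩
    · rw [mem_cone_iff hθ] at h1
      exact inner_nonneg _ _ h1.1 h2.1 h1.2 h2.2
    · rw [mem_cone_iff hθ] at h2
      have := inner_nonneg _ _ h2.1 h1.1 h2.2 h1.2
      linarith
  rw [← sq_le_sq₀ (norm_nonneg _) (norm_nonneg _), Complex.sq_norm, Complex.sq_norm,
    Complex.normSq_apply, Complex.normSq_apply]
  simp only [Complex.sub_re, Complex.sub_im] at *
  nlinarith [sq_nonneg (d.re - b.re), sq_nonneg (d.im - b.im)]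

/-- `E` is a union of explored regions, whose cones contain `x`. -/
def IsHistory (θ : ℝ) (x : ℂ) (E : Set ℂ) : Prop :=
  ∀ w ∈ E, ∃ (c : ℂ) (r : ℝ), x ∈ cone θ c ∧ w ∈ Metric.ball c r ∧
    cone θ c ∩ Metric.ball c r ⊆ E

theorem isHistory_empty (θ : ℝ) (x : ℂ) : IsHistory θ x ∅ := fun _ h => h.elim

theorem IsHistory.union_explored (hθ : θ ∈ Set.Ioo 0 (Real.pi / 2)) {x y : ℂ} {E : Set ℂ}
    (hE : IsHistory θ x E) (hy : y ∈ cone θ x) : IsHistory θ y (E ∪ explored θ x y) := by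
  rintro w (hw | hw)
  · obtain ⟨c, r, hx, hwr, hs⟩ := hE w hw
    exact ⟨c, r, cone_subset_cone hθ hx hy, hwr, hs.trans Set.subset_union_left⟩
  · exact ⟨x, ‖y - x‖, hy, hw.2, Set.subset_union_right⟩

/-- The point x lies in the cone of each region of E but not in E, hence outside the ball that cuts
the region off. A point of the narrow cone at x is at least as far from the centre as x, so it is
outside too. Every later probability bound uses this fresh territory. -/
theorem IsHistory.disjoint_narrowCone (hθ : θ ∈ Set.Ioo 0 (Real.pi / 2)) {x : ℂ} {E : Set ℂ}
    (hE : IsHistory θ x E) (hx : x ∉ E) : Disjoint (narrowCone θ x) E := by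
  rw [Set.disjoint_left]
  intro w hw hwE
  obtain ⟨c, r, hxc, hwr, hs⟩ := hE w hwE
  have h1 := norm_sub_le_of_cone_narrowCone hθ (Or.inl ⟨hxc, hw⟩)
  rw [Metric.mem_ball, dist_eq_norm] at hwr
  exact hx (hs ⟨hxc, by rw [Metric.mem_ball, dist_eq_norm]; exact h1.trans_lt hwr⟩)

/-- The regions are cut off by open balls, so a history that meets the cone meets it in positive
area. Renewals can thus be tested by an area, which is measurable in all parameters. -/
theorem IsHistory.volume_eq_zero_iff (hθ : θ ∈ Set.Ioo 0 (Real.pi / 2)) {x : ℂ} {E : Set ℂ}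
    (hE : IsHistory θ x E) : volume (cone θ x ∩ E) = 0 ↔ cone θ x ∩ E = ∅ := by
  constructor
  · intro h
    by_contra hne
    obtain ⟨w, hwx, hwE⟩ := Set.nonempty_iff_ne_empty.2 hne
    obtain ⟨c, r, hxc, hwr, hs⟩ := hE w hwE
    refine (volume_cone_inter_ball_pos hθ hwx hwr).ne' (measure_mono_null ?_ h)
    exact fun z hz => ⟨hz.1, hs ⟨cone_subset_cone hθ hxc hz.1, hz.2⟩⟩
  · intro h
    rw [h, measure_empty]

/-- A ball of radius proportional to `r` inside the part of the narrow cone at distance less than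
`r` from the apex. -/
theorem exists_ball_subset_narrowCone (hθ : θ ∈ Set.Ioo 0 (Real.pi / 2)) :
    ∃ δ : ℝ, 0 < δ ∧ ∀ (x : ℂ) (r : ℝ), 0 ≤ r →
      Metric.ball (x + ((r / 2 : ℝ) : ℂ)) (δ * r) ⊆ narrowCone θ x ∩ Metric.ball x r := by
  have hm := narrowSlope_pos hθ
  set m := narrowSlope θ
  -- This δ solves δ = m (1/2 - δ): points of the ball have height less than δr and horizontal
  -- offset more than (1/2 - δ)r.
  refine ⟨m / (2 * (1 + m)), by positivity, fun x r hr w hw => ?_⟩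
  have hd : m / (2 * (1 + m)) < 1 / 2 := by
    rw [div_lt_div_iff₀ (by positivity) (by norm_num)]; linarith
  have hde : (m / (2 * (1 + m))) * (1 + m) = m / 2 := by field_simp
  set δ := m / (2 * (1 + m))
  rw [Metric.mem_ball, dist_eq_norm] at hw
  have hre := (Complex.abs_re_le_norm _).trans_lt hw
  have him := (Complex.abs_im_le_norm _).trans_lt hw
  simp only [Complex.sub_re, Complex.sub_im, Complex.add_re, Complex.add_im,
    Complex.ofReal_re, Complex.ofReal_im, add_zero, abs_lt] at hre him
  refine ⟨⟨?_, ?_⟩, ?_⟩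
  · simp only [Complex.sub_re]; nlinarith
  · simp only [Complex.sub_re, Complex.sub_im, abs_le]
    constructor <;> nlinarith
  · rw [Metric.mem_ball, dist_eq_norm]
    calc ‖w - x‖ = ‖(w - (x + ((r / 2 : ℝ) : ℂ))) + ((r / 2 : ℝ) : ℂ)‖ := by ring_nf
      _ ≤ ‖w - (x + ((r / 2 : ℝ) : ℂ))‖ + ‖((r / 2 : ℝ) : ℂ)‖ := norm_add_le _ _
      _ = ‖w - (x + ((r / 2 : ℝ) : ℂ))‖ + r / 2 := by
        rw [Complex.norm_real, Real.norm_of_nonneg (by linarith)]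
      _ < r := by nlinarith

theorem volume_cone_eq_top (hθ : θ ∈ Set.Ioo 0 (Real.pi / 2)) (x : ℂ) :
    volume (cone θ x) = ∞ := by
  obtain ⟨δ, hδ, h⟩ := exists_ball_subset_narrowCone hθ
  refine ENNReal.eq_top_of_forall_nnreal_le fun M => ?_
  set r : ℝ := (M + 1) / δ with hr
  have hr0 : 0 ≤ r := by positivity
  have hδr : δ * r = M + 1 := by rw [hr]; field_simp
  calc (M : ℝ≥0∞) ≤ volume (Metric.ball (x + ((r / 2 : ℝ) : ℂ)) (δ * r)) := by
        rw [Complex.volume_ball, hδr]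
        have h1 : (M : ℝ≥0∞) ≤ ENNReal.ofReal (M + 1) ^ 2 := by
          rw [← ENNReal.ofReal_pow (by positivity), ← ENNReal.ofReal_coe_nnreal]
          exact ENNReal.ofReal_le_ofReal (by nlinarith [M.2, NNReal.coe_nonneg M])
        have h2 : (1 : ℝ≥0∞) ≤ (NNReal.pi : ℝ≥0∞) := by
          have : (1 : ℝ≥0) ≤ NNReal.pi := by
            rw [← NNReal.coe_le_coe]; simpa using (by linarith [Real.pi_gt_three] : (1:ℝ) ≤ Real.pi)
          exact_mod_cast this
        calc (M : ℝ≥0∞) = M * 1 := (mul_one _).symm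
          _ ≤ _ := mul_le_mul' h1 h2
    _ ≤ _ := measure_mono ((h x r hr0).trans
        (Set.inter_subset_left.trans (narrowCone_subset_cone hθ x)))

end Geometry

/-! ### The measurable space of locally finite configurations -/

section Configurations

/-- A locally finite set of points of the plane. -/
structure Config where
  /-- the points of the configuration -/
  points : Set ℂ
  finite_inter_ball : ∀ n : ℕ, (points ∩ Metric.ball 0 n).Finite

/-- The configurations without a point in `A`. -/
def voidEvent (A : Set ℂ) : Set Config := {S | S.points ∩ A = ∅}

theorem voidEvent_inter (A B : Set ℂ) : voidEvent A ∩ voidEvent B = voidEvent (A ∪ B) := by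
  ext S
  simp [voidEvent, Set.inter_union_distrib_left, Set.union_empty_iff]

/-- The void events of Borel sets. -/
def voidEvents : Set (Set Config) := {V | ∃ A, MeasurableSet A ∧ V = voidEvent A}

theorem isPiSystem_voidEvents : IsPiSystem voidEvents := by
  rintro _ ⟨A, hA, rfl⟩ _ ⟨B, hB, rfl⟩ -
  exact ⟨A ∪ B, hA.union hB, voidEvent_inter A B⟩

/-- The void events form a π-system, and the counts are measurable for the σ-algebra that they
generate (`measurable_encard_inter`). So identities of measures need checking on void events only.
-/
instance : MeasurableSpace Config := MeasurableSpace.generateFrom voidEvents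

theorem measurableSet_voidEvent {A : Set ℂ} (hA : MeasurableSet A) :
    MeasurableSet (voidEvent A) :=
  MeasurableSpace.measurableSet_generateFrom ⟨A, hA, rfl⟩

/-- Finitely many points are separated by disjoint sets of a countable basis. This writes the event
of at least k points as a countable combination of void events. -/
theorem le_encard_iff_exists_basis (T : Set ℂ) (k : ℕ) :
    (k : ℕ∞) ≤ T.encard ↔ ∃ u : Fin k → TopologicalSpace.countableBasis ℂ,
      (Pairwise fun i j => Disjoint (u i : Set ℂ) (u j)) ∧ ∀ i, (T ∩ u i).Nonempty := by
  constructor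
  · intro h
    obtain ⟨t, htT, ht⟩ := Set.exists_subset_encard_eq h
    have hfin : t.Finite := Set.finite_of_encard_eq_coe ht
    obtain ⟨U, hU, hdisj⟩ := hfin.t2_separation
    have hcard : hfin.toFinset.card = k := by
      rw [hfin.encard_eq_coe_toFinset_card] at ht
      exact_mod_cast ht
    let e : Fin k ≃ hfin.toFinset := (finCongr hcard.symm).trans hfin.toFinset.equivFin.symm
    have hb : ∀ x : ℂ, ∃ v ∈ TopologicalSpace.countableBasis ℂ, x ∈ v ∧ v ⊆ U x := fun x =>
      (TopologicalSpace.isBasis_countableBasis ℂ).exists_subset_of_mem_open (hU x).1 (hU x).2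
    choose v hv hxv hvU using hb
    have hmem : ∀ i, (e i : ℂ) ∈ t := fun i => hfin.mem_toFinset.1 (e i).2
    refine ⟨fun i => ⟨v (e i), hv _⟩, fun i j hij => ?_, fun i => ⟨e i, htT (hmem i), hxv _⟩⟩
    have hne : (e i : ℂ) ≠ e j := fun h => hij (e.injective (Subtype.ext h))
    exact (hdisj (hmem i) (hmem j) hne).mono (hvU _) (hvU _)
  · rintro ⟨u, hu, hT⟩
    choose p hp using hT
    have hinj : Function.Injective p := by
      intro i j hij
      by_contra hne
      exact Set.disjoint_left.1 (hu hne) (hp i).2 (hij ▸ (hp j).2)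
    calc (k : ℕ∞) = (Set.range p).encard := by
          rw [← Set.image_univ, hinj.encard_image, Set.encard_univ, ENat.card_eq_coe_fintype_card,
            Fintype.card_fin]
      _ ≤ T.encard := Set.encard_le_encard (by rintro _ ⟨i, rfl⟩; exact (hp i).1)

theorem measurable_encard_inter {B : Set ℂ} (hB : MeasurableSet B) :
    Measurable fun S : Config => (S.points ∩ B).encard := by
  have hk : ∀ k : ℕ, MeasurableSet {S : Config | (k : ℕ∞) ≤ (S.points ∩ B).encard} := by
    intro k
    have : {S : Config | (k : ℕ∞) ≤ (S.points ∩ B).encard} =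
        ⋃ u : Fin k → TopologicalSpace.countableBasis ℂ,
          ⋃ _ : Pairwise fun i j => Disjoint (u i : Set ℂ) (u j),
            ⋂ i, (voidEvent (B ∩ u i))ᶜ := by
      ext S
      simp only [Set.mem_ofPred_eq, le_encard_iff_exists_basis, Set.mem_iUnion, Set.mem_iInter,
        voidEvent, Set.mem_compl_iff, ← Set.nonempty_iff_ne_empty, Set.inter_assoc, exists_prop,
        ← ne_eq]
    rw [this]
    have : Countable (TopologicalSpace.countableBasis ℂ) :=
      (TopologicalSpace.countable_countableBasis ℂ).to_subtype
    refine MeasurableSet.iUnion fun u => MeasurableSet.iUnion fun _ => MeasurableSet.iInter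
      fun i => (measurableSet_voidEvent (hB.inter ?_)).compl
    exact ((TopologicalSpace.isBasis_countableBasis ℂ).isOpen (u i).2).measurableSet
  refine ENat.measurable_iff.2 fun n => ?_
  convert (hk n).diff (hk (n + 1)) using 1
  ext S
  simp only [Set.mem_preimage, Set.mem_singleton_iff, Set.mem_sdiff, Set.mem_ofPred_eq, not_le,
    Nat.cast_add, Nat.cast_one]
  constructor
  · intro h
    rw [h]
    exact ⟨le_rfl, by exact_mod_cast Nat.lt_succ_self n⟩
  · rintro ⟨h1, h2⟩
    exact le_antisymm (Order.lt_add_one_iff_of_not_isMax (by simp) |>.1 h2) h1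

theorem Config.countable (S : Config) : S.points.Countable := by
  have : S.points = ⋃ n : ℕ, S.points ∩ Metric.ball 0 n := by
    rw [← Set.inter_iUnion, Metric.iUnion_ball_nat, Set.inter_univ]
  rw [this]
  exact Set.countable_iUnion fun n => (S.finite_inter_ball n).countable

/-- The kernel that sends a configuration to the counting measure of its points. -/
noncomputable def pointKernel : Kernel Config ℂ where
  toFun S := Measure.count.restrict S.points
  measurable' := by
    refine Measure.measurable_of_measurable_coe _ fun B hB => ?_
    have : ∀ S : Config, Measure.count.restrict S.points B =
        (((S.points ∩ B).encard : ℕ∞) : ℝ≥0∞) := fun S => by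
      rw [Measure.restrict_apply hB, Set.inter_comm,
        Measure.count_apply (S.countable.measurableSet.inter hB)]
    simp only [this]
    exact Measurable.of_discrete.comp (measurable_encard_inter hB)

theorem pointKernel_apply (S : Config) : pointKernel S = Measure.count.restrict S.points := rfl

theorem pointKernel_apply_apply (S : Config) {B : Set ℂ} (hB : MeasurableSet B) :
    pointKernel S B = ((S.points ∩ B).encard : ℕ∞) := by
  rw [pointKernel_apply, Measure.restrict_apply hB, Set.inter_comm,
        Measure.count_apply (S.countable.measurableSet.inter hB)]

/-- The plane is cut into bounded shells and the configurations by the number m of points in a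
shell. Each piece has mass at most m, and local finiteness leaves exactly one m per shell. -/
instance : IsSFiniteKernel pointKernel := by
  classical
  set A : ℕ → Set ℂ := disjointed fun n : ℕ => Metric.ball 0 n with hA
  have hAm : ∀ n, MeasurableSet (A n) := MeasurableSet.disjointed fun n => measurableSet_ball
  have hAu : ⋃ n, A n = Set.univ := by rw [hA, iUnion_disjointed, Metric.iUnion_ball_nat]
  have hm : ∀ n m : ℕ, MeasurableSet {S : Config | (S.points ∩ A n).encard = m} := fun n m =>
    measurable_encard_inter (hAm n) (measurableSet_singleton _)
  let κ : ℕ → ℕ → Kernel Config ℂ := fun n m =>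
    Kernel.piecewise (hm n m) (pointKernel.restrict (hAm n)) 0
  have hfin : ∀ n m, IsFiniteKernel (κ n m) := by
    refine fun n m => ⟨⟨m, ENNReal.natCast_lt_top m, fun S => ?_⟩⟩
    simp only [κ, Kernel.piecewise_apply]
    split_ifs with h
    · rw [Kernel.restrict_apply, Measure.restrict_apply_univ,
        pointKernel_apply_apply _ (hAm n)]
      rw [Set.mem_ofPred_eq] at h
      simp [h]
    · simp
  have : pointKernel = Kernel.sum fun n => Kernel.sum fun m => κ n m := by
    ext S B hB
    rw [Kernel.sum_apply' _ _ hB]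
    have h1 : ∀ n, Kernel.sum (fun m => κ n m) S B = pointKernel S (B ∩ A n) := by
      intro n
      rw [Kernel.sum_apply' _ _ hB]
      have hf : (S.points ∩ A n).Finite :=
        (S.finite_inter_ball n).subset (Set.inter_subset_inter_right _ (disjointed_subset _ _))
      obtain ⟨m, hmS⟩ : ∃ m : ℕ, (S.points ∩ A n).encard = m :=
        ⟨_, hf.encard_eq_coe_toFinset_card⟩
      rw [tsum_eq_single m]
      · simp only [κ, Kernel.piecewise_apply, Set.mem_ofPred_eq, hmS, if_true]
        rw [Kernel.restrict_apply, Measure.restrict_apply hB]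
      · intro m' hm'
        simp only [κ, Kernel.piecewise_apply, Set.mem_ofPred_eq, hmS]
        rw [if_neg (by exact_mod_cast hm'.symm)]
        simp
    simp only [h1]
    rw [← measure_iUnion (fun i j hij => ?_) fun n => hB.inter (hAm n), ← Set.inter_iUnion, hAu,
      Set.inter_univ]
    exact ((disjoint_disjointed _ hij).mono Set.inter_subset_right Set.inter_subset_right)
  rw [this]
  infer_instance

theorem measurable_lintegral_pointKernel {α : Type*} [MeasurableSpace α]
    {f : α × Config → ℂ → ℝ≥0∞} (hf : Measurable (Function.uncurry f)) :
    Measurable fun p : α × Config => ∫⁻ y, f p y ∂pointKernel p.2 := by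
  have := Measurable.lintegral_kernel_prod_right
    (κ := pointKernel.comap (Prod.snd : α × Config → Config) measurable_snd) hf
  simpa [Kernel.comap_apply] using this

/-- Void events of sets that depend on a parameter are jointly measurable, since emptiness means
that an integral against `pointKernel` vanishes. -/
theorem measurableSet_inter_eq_empty {α : Type*} [MeasurableSpace α] {A : Set (α × ℂ)}
    (hA : MeasurableSet A) :
    MeasurableSet {p : α × Config | p.2.points ∩ Prod.mk p.1 ⁻¹' A = ∅} := by
  have h : Measurable fun p : α × Config =>
      ∫⁻ y, A.indicator (fun _ => (1 : ℝ≥0∞)) (p.1, y) ∂pointKernel p.2 := by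
    refine measurable_lintegral_pointKernel (f := fun p y => A.indicator (fun _ => 1) (p.1, y)) ?_
    exact (measurable_const.indicator hA).comp
      (g := A.indicator fun _ => (1 : ℝ≥0∞))
      (f := fun q : (α × Config) × ℂ => (q.1.1, q.2)) (by fun_prop)
  convert h (measurableSet_singleton 0) using 1
  ext p
  have h1 : ∀ y, A.indicator (fun _ => (1 : ℝ≥0∞)) (p.1, y) =
      (Prod.mk p.1 ⁻¹' A).indicator (fun _ => 1) y := fun y => rfl
  have h2 : MeasurableSet (Prod.mk p.1 ⁻¹' A) := measurable_prodMk_left hA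
  simp only [Set.mem_ofPred_eq, Set.mem_preimage, Set.mem_singleton_iff, h1]
  rw [lintegral_indicator_const h2, pointKernel_apply_apply _ h2]
  simp

/-- Adding a point to a configuration. -/
def Config.insert (y : ℂ) (S : Config) : Config where
  points := Insert.insert y S.points
  finite_inter_ball n := ((S.finite_inter_ball n).insert y).subset (by
    rintro z ⟨rfl | hz, hn⟩
    · exact Or.inl rfl
    · exact Or.inr ⟨hz, hn⟩)

theorem Config.insert_points (y : ℂ) (S : Config) :
    (S.insert y).points = Insert.insert y S.points := rfl

theorem insert_mem_voidEvent {y : ℂ} {S : Config} {A : Set ℂ} :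
    S.insert y ∈ voidEvent A ↔ y ∉ A ∧ S ∈ voidEvent A := by
  simp only [voidEvent, Set.mem_ofPred_eq, Config.insert_points]
  constructor
  · intro h
    refine ⟨fun hy => ?_, ?_⟩
    · exact Set.notMem_empty y (h ▸ ⟨Set.mem_insert _ _, hy⟩)
    · exact Set.subset_empty_iff.1 (h ▸ Set.inter_subset_inter_left _ (Set.subset_insert _ _))
  · rintro ⟨hy, h⟩
    rw [Set.insert_inter_of_notMem hy, h]

theorem measurable_insert : Measurable fun p : ℂ × Config => p.2.insert p.1 := by
  refine measurable_generateFrom ?_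
  rintro _ ⟨A, hA, rfl⟩
  have : (fun p : ℂ × Config => p.2.insert p.1) ⁻¹' voidEvent A = Aᶜ ×ˢ voidEvent A := by
    ext p
    simp only [Set.mem_preimage, insert_mem_voidEvent, Set.mem_prod, Set.mem_compl_iff]
  rw [this]
  exact hA.compl.prod (measurableSet_voidEvent hA)

end Configurations

/-! ### Void probabilities and the Mecke equation -/

section PoissonLaw

/-- The function `exp (-t)` of an extended nonnegative number `t`. -/
noncomputable def expNeg (t : ℝ≥0∞) : ℝ≥0∞ :=
  if t = ∞ then 0 else ENNReal.ofReal (Real.exp (-t.toReal))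

theorem expNeg_top : expNeg ∞ = 0 := if_pos rfl

theorem expNeg_of_ne_top {t : ℝ≥0∞} (ht : t ≠ ∞) :
    expNeg t = ENNReal.ofReal (Real.exp (-t.toReal)) := if_neg ht

theorem expNeg_zero : expNeg 0 = 1 := by simp [expNeg]

theorem expNeg_add (s t : ℝ≥0∞) : expNeg (s + t) = expNeg s * expNeg t := by
  by_cases hs : s = ∞
  · simp [hs, expNeg_top]
  by_cases ht : t = ∞
  · simp [ht, expNeg_top]
  rw [expNeg_of_ne_top hs, expNeg_of_ne_top ht, expNeg_of_ne_top (ENNReal.add_ne_top.2 ⟨hs, ht⟩),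
    ENNReal.toReal_add hs ht, neg_add, Real.exp_add, ENNReal.ofReal_mul (Real.exp_pos _).le]

theorem expNeg_ne_zero {t : ℝ≥0∞} (ht : t ≠ ∞) : expNeg t ≠ 0 := by
  rw [expNeg_of_ne_top ht]
  simp [Real.exp_pos]

theorem expNeg_antitone : Antitone expNeg := by
  intro s t h
  by_cases ht : t = ∞
  · simp [ht, expNeg_top]
  have hs : s ≠ ∞ := (h.trans_lt (lt_top_iff_ne_top.2 ht)).ne
  rw [expNeg_of_ne_top hs, expNeg_of_ne_top ht]
  exact ENNReal.ofReal_le_ofReal (Real.exp_le_exp.2 (neg_le_neg (ENNReal.toReal_mono ht h)))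

theorem expNeg_le_one (t : ℝ≥0∞) : expNeg t ≤ 1 := expNeg_zero ▸ expNeg_antitone (zero_le : 0 ≤ t)

theorem expNeg_ne_top (t : ℝ≥0∞) : expNeg t ≠ ∞ := ((expNeg_le_one t).trans_lt ENNReal.one_lt_top).ne

theorem measurable_expNeg : Measurable expNeg := expNeg_antitone.measurable

/-- The properties of the law of a Poisson process with intensity `lam` that are used below: the
void probabilities and the Mecke equation. -/
structure IsPoissonLaw (lam : ℝ≥0) (Q : Measure Config) : Prop where
  isProbabilityMeasure : IsProbabilityMeasure Q
  void : ∀ A, MeasurableSet A → Q (voidEvent A) = expNeg (lam * volume A)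
  mecke : ∀ h : ℂ × Config → ℝ≥0∞, Measurable h →
    ∫⁻ S, ∫⁻ y, h (y, S) ∂pointKernel S ∂Q = lam * ∫⁻ y, ∫⁻ S, h (y, S.insert y) ∂Q

open Classical in
/-- A set of points as a configuration; it is replaced by the empty set if it is not locally
finite. -/
noncomputable def toConfig (S : Set ℂ) : Config :=
  if h : ∀ n : ℕ, (S ∩ Metric.ball 0 n).Finite then ⟨S, h⟩ else ⟨∅, by simp⟩

variable {Ω : Type*} [MeasurableSpace Ω] {μ : Measure Ω} {lam : ℝ≥0} {P : Ω → Set ℂ}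

theorem IsPoissonProcess.measure_count_eq (hP : IsPoissonProcess μ lam P) {B : Set ℂ}
    (hB : MeasurableSet B) (hBv : volume B ≠ ∞) (T : Set ℕ∞) :
    μ {ω | (P ω ∩ B).encard ∈ T} =
      poissonMeasure (lam * (volume B).toNNReal) {n : ℕ | (n : ℕ∞) ∈ T} := by
  have h := hP.map_count B hB hBv
  have h1 := Measure.map_apply (μ := μ) (hP.measurable_count B hB)
    (MeasurableSet.of_discrete (s := T))
  rw [h, Measure.map_apply Measurable.of_discrete MeasurableSet.of_discrete] at h1
  exact h1.symm

theorem IsPoissonProcess.ae_locallyFinite (hP : IsPoissonProcess μ lam P) :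
    ∀ᵐ ω ∂μ, ∀ n : ℕ, (P ω ∩ Metric.ball 0 n).Finite := by
  rw [ae_all_iff]
  intro n
  have h := hP.measure_count_eq (measurableSet_ball (x := (0 : ℂ)) (ε := (n : ℝ)))
    measure_ball_lt_top.ne {⊤}
  rw [ae_iff]
  convert h using 1
  · congr 1
    ext ω
    simp only [Set.mem_ofPred_eq, Set.mem_singleton_iff, Set.encard_eq_top_iff,
      Set.Infinite]
  · simp

theorem IsPoissonProcess.toConfig_ae_eq (hP : IsPoissonProcess μ lam P) :
    ∀ᵐ ω ∂μ, (toConfig (P ω)).points = P ω := by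
  filter_upwards [hP.ae_locallyFinite] with ω hω
  rw [toConfig, dif_pos hω]

theorem IsPoissonProcess.measurable_toConfig (hP : IsPoissonProcess μ lam P) :
    Measurable fun ω => toConfig (P ω) := by
  set F : Set Ω := {ω | ∀ n : ℕ, (P ω ∩ Metric.ball 0 n).Finite} with hF
  have hFm : MeasurableSet F := by
    have : F = ⋂ n : ℕ, {ω | (P ω ∩ Metric.ball 0 n).encard ∈ ({⊤}ᶜ : Set ℕ∞)} := by
      ext ω
      simp only [hF, Set.mem_ofPred_eq, Set.mem_iInter, Set.mem_compl_iff, Set.mem_singleton_iff,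
        Set.encard_eq_top_iff, Set.not_infinite]
    rw [this]
    exact MeasurableSet.iInter fun n =>
      hP.measurable_count _ measurableSet_ball MeasurableSet.of_discrete
  refine measurable_generateFrom ?_
  rintro _ ⟨A, hA, rfl⟩
  have : (fun ω => toConfig (P ω)) ⁻¹' voidEvent A =
      (F ∩ {ω | (P ω ∩ A).encard ∈ ({0} : Set ℕ∞)}) ∪ Fᶜ := by
    ext ω
    by_cases hω : ω ∈ F
    · have : (toConfig (P ω)).points = P ω := by
        rw [toConfig, dif_pos (show ∀ n : ℕ, (P ω ∩ Metric.ball 0 n).Finite from hω)]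
      simp [voidEvent, this, hω]
    · have : (toConfig (P ω)).points = ∅ := by
        rw [toConfig, dif_neg (show ¬ ∀ n : ℕ, (P ω ∩ Metric.ball 0 n).Finite from hω)]
      simp [voidEvent, this, hω]
  rw [this]
  exact (hFm.inter (hP.measurable_count A hA MeasurableSet.of_discrete)).union hFm.compl

theorem IsPoissonProcess.measure_void (hP : IsPoissonProcess μ lam P) (hlam : 0 < lam) {A : Set ℂ}
    (hA : MeasurableSet A) : μ {ω | P ω ∩ A = ∅} = expNeg (lam * volume A) := by
  have hfin : ∀ B, MeasurableSet B → volume B ≠ ∞ →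
      μ {ω | P ω ∩ B = ∅} = expNeg (lam * volume B) := by
    intro B hB hBv
    have h := hP.measure_count_eq hB hBv {0}
    have h0 : {n : ℕ | (n : ℕ∞) ∈ ({0} : Set ℕ∞)} = {0} := by ext n; simp
    rw [h0, poissonMeasure_singleton] at h
    simp only [Set.mem_singleton_iff, Set.encard_eq_zero] at h
    rw [h, expNeg_of_ne_top (ENNReal.mul_ne_top ENNReal.coe_ne_top hBv)]
    simp only [pow_zero, mul_one, Nat.factorial_zero, Nat.cast_one, div_one, ENNReal.toReal_mul]
    rfl
  -- For infinite area, the void probability is at most that of A intersected with a large ball,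
  -- whose area is finite and exceeds any bound. Positive intensity excludes the product 0 · ∞.
  by_cases hAv : volume A = ∞
  · have hl : (lam : ℝ≥0∞) ≠ 0 := by exact_mod_cast hlam.ne'
    rw [hAv, ENNReal.mul_top hl, expNeg_top]
    have hup : Filter.Tendsto (fun n : ℕ => volume (A ∩ Metric.ball 0 n)) Filter.atTop
        (nhds ∞) := by
      have := tendsto_measure_iUnion_atTop (μ := volume) (s := fun n : ℕ => A ∩ Metric.ball 0 n)
        (fun i j hij => Set.inter_subset_inter_right _
          (Metric.ball_subset_ball (by exact_mod_cast hij)))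
      rwa [← Set.inter_iUnion, Metric.iUnion_ball_nat, Set.inter_univ, hAv] at this
    refine le_antisymm (le_of_forall_pos_le_add ?_) zero_le
    intro ε hε
    by_cases hεt : ε = ∞
    · simp [hεt]
    obtain ⟨t, ht⟩ : ∃ t : ℝ≥0, ENNReal.ofReal (Real.exp (-t)) ≤ ε := by
      have h1 : Filter.Tendsto (fun t : ℝ => ENNReal.ofReal (Real.exp (-t))) Filter.atTop
          (nhds 0) := by
        rw [← ENNReal.ofReal_zero]
        exact ENNReal.tendsto_ofReal (Real.tendsto_exp_neg_atTop_nhds_zero)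
      obtain ⟨t, ht⟩ := ((h1.eventually (gt_mem_nhds hε)).and
        (Filter.eventually_ge_atTop (0 : ℝ))).exists
      exact ⟨⟨t, ht.2⟩, ht.1.le⟩
    obtain ⟨n, hn⟩ := (hup.eventually
      (lt_mem_nhds (show ((t / lam : ℝ≥0) : ℝ≥0∞) < ∞ from ENNReal.coe_lt_top))).exists
    have hv : volume (A ∩ Metric.ball 0 (n : ℝ)) ≠ ∞ :=
      ((measure_mono Set.inter_subset_right).trans_lt measure_ball_lt_top).ne
    rw [zero_add]
    calc μ {ω | P ω ∩ A = ∅} ≤ μ {ω | P ω ∩ (A ∩ Metric.ball 0 (n : ℝ)) = ∅} :=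
          measure_mono fun ω (hω : P ω ∩ A = ∅) => Set.subset_empty_iff.1
            (hω ▸ Set.inter_subset_inter_right _ Set.inter_subset_left)
      _ = expNeg (lam * volume (A ∩ Metric.ball 0 (n : ℝ))) :=
          hfin _ (hA.inter measurableSet_ball) hv
      _ ≤ expNeg t := by
          refine expNeg_antitone ?_
          calc (t : ℝ≥0∞) = lam * ((t / lam : ℝ≥0) : ℝ≥0∞) := by
                rw [← ENNReal.coe_mul, mul_div_cancel₀ _ hlam.ne']
            _ ≤ _ := by gcongr
      _ = ENNReal.ofReal (Real.exp (-t)) := by rw [expNeg_of_ne_top ENNReal.coe_ne_top]; rfl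
      _ ≤ ε := ht
  · exact hfin A hA hAv

theorem lintegral_poissonMeasure_cast (r : ℝ≥0) :
    ∫⁻ n : ℕ, ((n : ℕ) : ℝ≥0∞) ∂poissonMeasure r = r := by
  have hs : HasSum (fun n : ℕ => Real.exp (-r) * (r : ℝ) ^ n / n.factorial * n) r := by
    -- The term with index 0 vanishes, and n + 1 cancels in (n + 1)!, which leaves r times the total
    -- mass.
    rw [← hasSum_nat_add_iff' 1]
    have h := (hasSum_one_poissonMeasure r).mul_left (r : ℝ)
    simp only [Finset.range_one, Finset.sum_singleton, Nat.cast_zero, mul_zero, sub_zero]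
    rw [mul_one] at h
    refine h.congr_fun fun n => ?_
    rw [Nat.factorial_succ]
    push_cast
    field_simp
    ring
  rw [lintegral_countable']
  simp only [poissonMeasure_singleton]
  have : ∀ n : ℕ, (n : ℝ≥0∞) * ENNReal.ofReal (Real.exp (-r) * (r : ℝ) ^ n / n.factorial) =
      ENNReal.ofReal (Real.exp (-r) * (r : ℝ) ^ n / n.factorial * n) := by
    intro n
    rw [ENNReal.ofReal_mul (by positivity), ENNReal.ofReal_natCast, mul_comm]
  simp only [this]
  rw [← ENNReal.ofReal_tsum_of_nonneg (fun n => by positivity) hs.summable, hs.tsum_eq,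
    ENNReal.ofReal_coe_nnreal]

/-- The intensity measure. -/
theorem IsPoissonProcess.lintegral_count (hP : IsPoissonProcess μ lam P) {B : Set ℂ}
    (hB : MeasurableSet B) :
    ∫⁻ ω, ((P ω ∩ B).encard : ℝ≥0∞) ∂μ = lam * volume B := by
  have hfin : ∀ B, MeasurableSet B → volume B ≠ ∞ →
      ∫⁻ ω, ((P ω ∩ B).encard : ℝ≥0∞) ∂μ = lam * volume B := by
    intro B hB hBv
    have h := lintegral_map (μ := μ) (f := fun m : ℕ∞ => (m : ℝ≥0∞)) Measurable.of_discrete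
      (hP.measurable_count B hB)
    rw [hP.map_count B hB hBv, lintegral_map Measurable.of_discrete Measurable.of_discrete] at h
    rw [← h]
    simp only [ENat.toENNReal_coe]
    rw [lintegral_poissonMeasure_cast, ENNReal.coe_mul, ENNReal.coe_toNNReal hBv]
  have hmeas : ∀ C, MeasurableSet C → Measurable fun ω => ((P ω ∩ C).encard : ℝ≥0∞) :=
    fun C hC => Measurable.of_discrete.comp (hP.measurable_count C hC)
  set A : ℕ → Set ℂ := disjointed fun n : ℕ => Metric.ball 0 n with hA
  have hAm : ∀ n, MeasurableSet (A n) := MeasurableSet.disjointed fun n => measurableSet_ball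
  have hAu : ⋃ n, A n = Set.univ := by rw [hA, iUnion_disjointed, Metric.iUnion_ball_nat]
  have hdis : Pairwise fun i j => Disjoint (B ∩ A i) (B ∩ A j) := fun i j hij =>
    (disjoint_disjointed _ hij).mono Set.inter_subset_right Set.inter_subset_right
  have hBu : B = ⋃ n, B ∩ A n := by rw [← Set.inter_iUnion, hAu, Set.inter_univ]
  have hcount : ∀ᵐ ω ∂μ, ((P ω ∩ B).encard : ℝ≥0∞) = ∑' n, ((P ω ∩ (B ∩ A n)).encard : ℝ≥0∞) := by
    filter_upwards [hP.toConfig_ae_eq] with ω hω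
    rw [← hω, ← pointKernel_apply_apply _ hB]
    simp only [← pointKernel_apply_apply _ (hB.inter (hAm _))]
    rw [← measure_iUnion hdis fun n => hB.inter (hAm n), ← hBu]
  rw [lintegral_congr_ae hcount, lintegral_tsum fun n => (hmeas _ (hB.inter (hAm n))).aemeasurable]
  have hv : ∀ n, volume (B ∩ A n) ≠ ∞ := fun n =>
    ((measure_mono (Set.inter_subset_right.trans (disjointed_subset (fun n : ℕ => Metric.ball 0 n)
      n))).trans_lt measure_ball_lt_top).ne
  simp only [fun n => hfin _ (hB.inter (hAm n)) (hv n)]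
  rw [ENNReal.tsum_mul_left, ← measure_iUnion hdis fun n => hB.inter (hAm n), ← hBu]

/-- The Mecke equation for rectangles. -/
theorem IsPoissonProcess.lintegral_count_void (hP : IsPoissonProcess μ lam P) (hlam : 0 < lam)
    {A B : Set ℂ} (hA : MeasurableSet A) (hB : MeasurableSet B) :
    ∫⁻ ω, ((P ω ∩ B).encard : ℝ≥0∞) * {ω | P ω ∩ A = ∅}.indicator 1 ω ∂μ =
      lam * volume (B \ A) * expNeg (lam * volume A) := by
  have hBA := hB.diff hA
  have hind := (hP.indep_count 2 ![B \ A, A] (by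
      intro i; fin_cases i
      · exact hBA
      · exact hA) (by
      intro i j hij
      fin_cases i <;> fin_cases j <;> simp_all [Set.disjoint_sdiff_left, Set.disjoint_sdiff_right])
      ).indepFun (i := 0) (j := 1) (by simp)
  have hind2 := hind.comp (φ := fun m : ℕ∞ => (m : ℝ≥0∞))
    (ψ := fun m : ℕ∞ => ({0} : Set ℕ∞).indicator (1 : ℕ∞ → ℝ≥0∞) m)
    Measurable.of_discrete Measurable.of_discrete
  have h := lintegral_mul_eq_lintegral_mul_lintegral_of_indepFun''
    (Measurable.of_discrete.comp (hP.measurable_count _ hBA)).aemeasurable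
    (Measurable.of_discrete.comp (hP.measurable_count _ hA)).aemeasurable hind2
  have e1 : ∀ ω, ({0} : Set ℕ∞).indicator (1 : ℕ∞ → ℝ≥0∞) (P ω ∩ A).encard =
      {ω | P ω ∩ A = ∅}.indicator 1 ω := by
    intro ω
    simp [Set.indicator_apply]
  -- If A is void, the points in B are those in B \ A, and their number is independent of the void
  -- event of A.
  have e2 : ∀ ω, ((P ω ∩ B).encard : ℝ≥0∞) * {ω | P ω ∩ A = ∅}.indicator 1 ω =
      ((P ω ∩ (B \ A)).encard : ℝ≥0∞) * {ω | P ω ∩ A = ∅}.indicator 1 ω := by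
    intro ω
    by_cases hω : P ω ∩ A = ∅
    · have : P ω ∩ B = P ω ∩ (B \ A) := by
        ext z
        constructor
        · rintro ⟨hz, hzB⟩
          exact ⟨hz, hzB, fun hzA => Set.notMem_empty z (hω ▸ ⟨hz, hzA⟩)⟩
        · rintro ⟨hz, hzB, -⟩
          exact ⟨hz, hzB⟩
      rw [this]
    · simp [hω]
  have hset : MeasurableSet {ω | P ω ∩ A = ∅} := by
    have : {ω | P ω ∩ A = ∅} = {ω | (P ω ∩ A).encard ∈ ({0} : Set ℕ∞)} := by ext ω; simp
    rw [this]
    exact hP.measurable_count A hA MeasurableSet.of_discrete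
  rw [lintegral_congr e2]
  refine Eq.trans ?_ (h.trans ?_)
  · refine lintegral_congr fun ω => ?_
    rw [← e1]
    rfl
  · congr 1
    · exact hP.lintegral_count hBA
    · refine Eq.trans (lintegral_congr fun ω => e1 ω) ?_
      rw [lintegral_indicator_one hset, hP.measure_void hlam hA]

/-- The two sides of the Mecke equation are integrals against measures on pairs of a configuration
and a point: `M₁` marks a point of the process, `M₂` adds an independent point. They agree on
products of a void event and a Borel set, a generating π-system, and both are finite on products
with balls. -/
theorem IsPoissonProcess.isPoissonLaw [IsProbabilityMeasure μ] (hP : IsPoissonProcess μ lam P)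
    (hlam : 0 < lam) : IsPoissonLaw lam (μ.map fun ω => toConfig (P ω)) := by
  have hmeas := hP.measurable_toConfig
  set Q := μ.map fun ω => toConfig (P ω) with hQ
  have hQp : IsProbabilityMeasure Q := Measure.isProbabilityMeasure_map hmeas.aemeasurable
  have hvoid : ∀ A, MeasurableSet A → Q (voidEvent A) = expNeg (lam * volume A) := by
    intro A hA
    rw [hQ, Measure.map_apply hmeas (measurableSet_voidEvent hA), ← hP.measure_void hlam hA]
    refine measure_congr ?_
    filter_upwards [hP.toConfig_ae_eq] with ω hω
    change (((toConfig (P ω)).points ∩ A = ∅) : Prop) = (P ω ∩ A = ∅)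
    rw [hω]
  refine ⟨hQp, hvoid, ?_⟩
  set M₁ : Measure (Config × ℂ) := Q ⊗ₘ pointKernel with hM₁
  set M₂ : Measure (Config × ℂ) :=
    ((lam : ℝ≥0∞) • ((volume : Measure ℂ).prod Q)).map fun p => (p.2.insert p.1, p.1) with hM₂
  have hins : Measurable fun p : ℂ × Config => (p.2.insert p.1, p.1) :=
    measurable_insert.prodMk measurable_fst
  have hval₁ : ∀ A B, MeasurableSet A → MeasurableSet B → M₁ (voidEvent A ×ˢ B) =
      lam * volume (B \ A) * expNeg (lam * volume A) := by
    intro A B hA hB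
    rw [hM₁, Measure.compProd_apply ((measurableSet_voidEvent hA).prod hB),
      ← hP.lintegral_count_void hlam hA hB, hQ, lintegral_map _ hmeas]
    · refine lintegral_congr_ae ?_
      filter_upwards [hP.toConfig_ae_eq] with ω hω
      by_cases h : P ω ∩ A = ∅
      · rw [Set.mk_preimage_prod_right (by simpa [voidEvent, hω] using h),
          pointKernel_apply_apply _ hB, hω]
        simp [h]
      · rw [Set.mk_preimage_prod_right_eq_empty (by simpa [voidEvent, hω] using h)]
        simp [h]
    · exact Kernel.measurable_kernel_prodMk_left ((measurableSet_voidEvent hA).prod hB)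
  have hval₂ : ∀ A B, MeasurableSet A → MeasurableSet B → M₂ (voidEvent A ×ˢ B) =
      lam * volume (B \ A) * expNeg (lam * volume A) := by
    intro A B hA hB
    rw [hM₂, Measure.map_apply hins ((measurableSet_voidEvent hA).prod hB)]
    have : (fun p : ℂ × Config => (p.2.insert p.1, p.1)) ⁻¹' (voidEvent A ×ˢ B) =
        (B \ A) ×ˢ voidEvent A := by
      ext p
      simp only [Set.mem_preimage, Set.mem_prod, insert_mem_voidEvent, Set.mem_sdiff]
      tauto
    rw [this, Measure.smul_apply, Measure.prod_prod, hvoid A hA, smul_eq_mul, mul_assoc]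
  have huniv : Set.univ ∈ voidEvents := ⟨∅, MeasurableSet.empty, by ext S; simp [voidEvent]⟩
  have hMM : M₁ = M₂ := by
    refine Measure.ext_of_generateFrom_of_iUnion
      (Set.image2 (· ×ˢ ·) voidEvents {B : Set ℂ | MeasurableSet B})
      (fun n : ℕ => Set.univ ×ˢ Metric.ball (0 : ℂ) n) ?_ ?_ ?_ ?_ ?_ ?_
    · refine (generateFrom_eq_prod rfl MeasurableSpace.generateFrom_measurableSet
        ⟨fun _ => Set.univ, fun _ => huniv, Set.iUnion_const _⟩
        isCountablySpanning_measurableSet).symm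
    · exact isPiSystem_voidEvents.prod MeasurableSpace.isPiSystem_measurableSet
    · rw [← Set.prod_iUnion, Metric.iUnion_ball_nat, Set.univ_prod_univ]
    · exact fun n => Set.mem_image2_of_mem huniv
        (show MeasurableSet (Metric.ball (0 : ℂ) n) from measurableSet_ball)
    · intro n
      have : (Set.univ : Set Config) = voidEvent ∅ := by ext S; simp [voidEvent]
      rw [this, hval₁ _ _ MeasurableSet.empty measurableSet_ball, Set.sdiff_empty]
      exact ENNReal.mul_ne_top (ENNReal.mul_ne_top ENNReal.coe_ne_top measure_ball_lt_top.ne)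
        (expNeg_ne_top _)
    · rintro _ ⟨_, ⟨A, hA, rfl⟩, B, hB, rfl⟩
      exact (hval₁ A B hA hB).trans (hval₂ A B hA hB).symm
  intro h hh
  have h1 : ∫⁻ p, h (p.2, p.1) ∂M₁ = ∫⁻ S, ∫⁻ y, h (y, S) ∂pointKernel S ∂Q :=
    Measure.lintegral_compProd (f := fun p : Config × ℂ => h (p.2, p.1)) (by fun_prop)
  have h2 : ∫⁻ p, h (p.2, p.1) ∂M₂ = lam * ∫⁻ y, ∫⁻ S, h (y, S.insert y) ∂Q := by
    rw [hM₂, lintegral_map (by fun_prop) hins, lintegral_smul_measure, smul_eq_mul,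
      lintegral_prod (fun p : ℂ × Config => h (p.1, p.2.insert p.1))
        (hh.comp (measurable_fst.prodMk measurable_insert)).aemeasurable]
  rw [← h1, hMM, h2]

end PoissonLaw

/-! ### Navigation paths as iterated sums over points -/

section PathSums

variable {θ : ℝ}

theorem lintegral_pointKernel_congr {S T : Config} {f g : ℂ → ℝ≥0∞}
    (h : S.points.indicator f = T.points.indicator g) :
    ∫⁻ y, f y ∂pointKernel S = ∫⁻ y, g y ∂pointKernel T := by
  rw [pointKernel_apply, pointKernel_apply, ← lintegral_indicator S.countable.measurableSet,
    ← lintegral_indicator T.countable.measurableSet, h]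

theorem lintegral_pointKernel_eq_single {S : Config} {f : ℂ → ℝ≥0∞} {y : ℂ} (hy : y ∈ S.points)
    (hf : ∀ u ∈ S.points, u ≠ y → f u = 0) : ∫⁻ u, f u ∂pointKernel S = f y := by
  rw [pointKernel_apply, ← lintegral_indicator S.countable.measurableSet]
  have : S.points.indicator f = ({y} : Set ℂ).indicator fun _ => f y := by
    ext u
    by_cases hu : u = y
    · simp [hu, hy]
    · by_cases huS : u ∈ S.points
      · simp [hu, huS, hf u huS hu]
      · simp [hu, huS]
  rw [this, lintegral_indicator_const (measurableSet_singleton y), Measure.count_singleton, mul_one]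

theorem le_lintegral_pointKernel {S : Config} {f : ℂ → ℝ≥0∞} {y : ℂ} (hy : y ∈ S.points) :
    f y ≤ ∫⁻ u, f u ∂pointKernel S := by
  classical
  calc f y = ∫⁻ u, (if u = y then f y else 0) ∂pointKernel S := by
        rw [lintegral_pointKernel_eq_single hy fun u _ hu => if_neg hu, if_pos rfl]
    _ ≤ _ := lintegral_mono fun u => by
        by_cases hu : u = y
        · simp [hu]
        · simp [hu]

theorem measurable_volume_cone_inter {α : Type*} [MeasurableSpace α]
    (hθ : θ ∈ Set.Ioo 0 (Real.pi / 2)) {x : α → ℂ} (hx : Measurable x) {E : Set (α × ℂ)}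
    (hE : MeasurableSet E) :
    Measurable fun p : α × ℂ =>
      volume (cone θ p.2 ∩ (Prod.mk p.1 ⁻¹' E ∪ explored θ (x p.1) p.2)) := by
  have h1 : MeasurableSet {q : (α × ℂ) × ℂ | q.2 ∈ cone θ q.1.2} :=
    (measurableSet_cone_prod hθ).preimage
      (f := fun q : (α × ℂ) × ℂ => (q.1.2, q.2)) (by fun_prop)
  have h2 : MeasurableSet {q : (α × ℂ) × ℂ | (q.1.1, q.2) ∈ E} :=
    hE.preimage (f := fun q : (α × ℂ) × ℂ => (q.1.1, q.2)) (by fun_prop)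
  have h3 : MeasurableSet {q : (α × ℂ) × ℂ | q.2 ∈ explored θ (x q.1.1) q.1.2} :=
    (measurableSet_explored_prod hθ).preimage
      (f := fun q : (α × ℂ) × ℂ => ((x q.1.1, q.1.2), q.2)) (by fun_prop)
  exact measurable_measure_prodMk_left (ν := (volume : Measure ℂ)) (h1.inter (h2.union h3))

theorem measurableSet_void_explored {α : Type*} [MeasurableSpace α]
    (hθ : θ ∈ Set.Ioo 0 (Real.pi / 2)) {x : α → ℂ} (hx : Measurable x) :
    MeasurableSet {q : (α × Config) × ℂ | q.1.2 ∈ voidEvent (explored θ (x q.1.1) q.2)} := by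
  have h3 : MeasurableSet {q : (α × ℂ) × ℂ | q.2 ∈ explored θ (x q.1.1) q.1.2} :=
    (measurableSet_explored_prod hθ).preimage
      (f := fun q : (α × ℂ) × ℂ => ((x q.1.1, q.1.2), q.2)) (by fun_prop)
  exact (measurableSet_inter_eq_empty h3).preimage
    (f := fun q : (α × Config) × ℂ => ((q.1.1, q.2), q.1.2)) (by fun_prop)

theorem measurableSet_mem_cone {α : Type*} [MeasurableSpace α]
    (hθ : θ ∈ Set.Ioo 0 (Real.pi / 2)) {x : α → ℂ} (hx : Measurable x) :
    MeasurableSet {q : (α × Config) × ℂ | q.2 ∈ cone θ (x q.1.1)} :=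
  (measurableSet_cone_prod hθ).preimage
      (f := fun q : (α × Config) × ℂ => (x q.1.1, q.2)) (by fun_prop)

open Classical in
/-- The number of navigation paths that start at `x` with explored region `E` and whose renewals
(no area of the cone at the new point has been explored) follow the pattern of the list. There
is at most one path if no ties occur. -/
noncomputable def pathSum (θ : ℝ) : List Bool → ℂ → Set ℂ → Config → ℝ≥0∞
  | [], _, _, _ => 1
  | b :: bs, x, E, S => ∫⁻ y, (if y ∈ cone θ x ∧ S ∈ voidEvent (explored θ x y) ∧
      (volume (cone θ y ∩ (E ∪ explored θ x y)) = 0 ↔ b = true)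
      then pathSum θ bs y (E ∪ explored θ x y) S else 0) ∂pointKernel S

open Classical in
/-- The probability that there is no point in `E` and that the renewals of the navigation started
at `x` with explored region `E` follow the pattern of the list. -/
noncomputable def pathProb (θ : ℝ) (lam : ℝ≥0) : List Bool → ℂ → Set ℂ → ℝ≥0∞
  | [], _, E => expNeg (lam * volume E)
  | b :: bs, x, E => lam * ∫⁻ y, (if y ∈ cone θ x ∧ y ∉ E ∧
      (volume (cone θ y ∩ (E ∪ explored θ x y)) = 0 ↔ b = true)
      then pathProb θ lam bs y (E ∪ explored θ x y) else 0)

theorem measurableSet_volume_cone_inter_iff {α : Type*} [MeasurableSpace α]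
    (hθ : θ ∈ Set.Ioo 0 (Real.pi / 2)) {x : α → ℂ} (hx : Measurable x) {E : Set (α × ℂ)}
    (hE : MeasurableSet E) (b : Bool) :
    MeasurableSet {q : (α × Config) × ℂ |
      volume (cone θ q.2 ∩ (Prod.mk q.1.1 ⁻¹' E ∪ explored θ (x q.1.1) q.2)) = 0 ↔ b = true} := by
  have h := (measurable_volume_cone_inter hθ hx hE (measurableSet_singleton 0)).preimage
    (f := fun q : (α × Config) × ℂ => (q.1.1, q.2)) (by fun_prop)
  cases b
  · convert h.compl using 1
    ext q
    simp
  · convert h using 1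
    ext q
    simp

open Classical in
theorem measurable_pathSum_term {α : Type} [MeasurableSpace α]
    (hθ : θ ∈ Set.Ioo 0 (Real.pi / 2)) {x : α → ℂ} (hx : Measurable x) {E : Set (α × ℂ)}
    (hE : MeasurableSet E) (b : Bool) {bs : List Bool}
    (h : ∀ {α : Type} [MeasurableSpace α] {x : α → ℂ} (_ : Measurable x) {E : Set (α × ℂ)}
      (_ : MeasurableSet E),
      Measurable fun p : α × Config => pathSum θ bs (x p.1) (Prod.mk p.1 ⁻¹' E) p.2) :
    Measurable fun q : (α × Config) × ℂ =>
      if q.2 ∈ cone θ (x q.1.1) ∧ q.1.2 ∈ voidEvent (explored θ (x q.1.1) q.2) ∧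
        (volume (cone θ q.2 ∩ (Prod.mk q.1.1 ⁻¹' E ∪ explored θ (x q.1.1) q.2)) = 0 ↔ b = true)
      then pathSum θ bs q.2 (Prod.mk q.1.1 ⁻¹' E ∪ explored θ (x q.1.1) q.2) q.1.2 else 0 := by
  refine Measurable.ite ?_ ?_ measurable_const
  · exact (measurableSet_mem_cone hθ hx).inter ((measurableSet_void_explored hθ hx).inter
      (measurableSet_volume_cone_inter_iff hθ hx hE b))
  · have h2 : MeasurableSet {q : (α × ℂ) × ℂ | (q.1.1, q.2) ∈ E} :=
      hE.preimage (f := fun q : (α × ℂ) × ℂ => (q.1.1, q.2)) (by fun_prop)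
    have h3 : MeasurableSet {q : (α × ℂ) × ℂ | q.2 ∈ explored θ (x q.1.1) q.1.2} :=
      (measurableSet_explored_prod hθ).preimage
        (f := fun q : (α × ℂ) × ℂ => ((x q.1.1, q.1.2), q.2)) (by fun_prop)
    exact (h (α := α × ℂ) measurable_snd (h2.union h3)).comp
      (f := fun q : (α × Config) × ℂ => ((q.1.1, q.2), q.1.2)) (by fun_prop)

/-- The statement ranges over all parameter spaces because the induction step adjoins the next point
to the parameters, and the later explored regions depend on it. -/
theorem measurable_pathSum (hθ : θ ∈ Set.Ioo 0 (Real.pi / 2)) (bs : List Bool) :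
    ∀ {α : Type} [MeasurableSpace α] {x : α → ℂ} (_ : Measurable x) {E : Set (α × ℂ)}
      (_ : MeasurableSet E),
      Measurable fun p : α × Config => pathSum θ bs (x p.1) (Prod.mk p.1 ⁻¹' E) p.2 := by
  induction bs with
  | nil => intro α _ x hx E hE; exact measurable_const
  | cons b bs ih =>
    intro α _ x hx E hE
    exact measurable_lintegral_pointKernel (measurable_pathSum_term hθ hx hE b ih)

theorem measurable_pathSum_const (hθ : θ ∈ Set.Ioo 0 (Real.pi / 2)) (bs : List Bool) (x : ℂ)
    {E : Set ℂ} (hE : MeasurableSet E) : Measurable (pathSum θ bs x E) :=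
  (measurable_pathSum hθ bs (α := Unit) (x := fun _ => x) measurable_const
    (E := Prod.snd ⁻¹' E) (measurable_snd hE)).comp (f := fun S : Config => ((), S)) (by fun_prop)

theorem insert_mem_voidEvent_explored {x y z : ℂ} {S : Config} (hz : z ∉ cone θ x) :
    S.insert z ∈ voidEvent (explored θ x y) ↔ S ∈ voidEvent (explored θ x y) := by
  rw [insert_mem_voidEvent, and_iff_right]
  exact fun h => hz h.1

open Classical in
-- A point outside the cone at x can neither extend a path from x nor lie in one of its explored
-- regions, as cones are nested. It is applied to the apex itself, which is not in its own cone.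
theorem pathSum_insert (hθ : θ ∈ Set.Ioo 0 (Real.pi / 2)) (bs : List Bool) :
    ∀ (x z : ℂ) (E : Set ℂ) (S : Config), z ∉ cone θ x →
      pathSum θ bs x E (S.insert z) = pathSum θ bs x E S := by
  induction bs with
  | nil => intro x z E S _; rfl
  | cons b bs ih =>
    intro x z E S hz
    refine lintegral_pointKernel_congr ?_
    ext y
    by_cases hy : y ∈ cone θ x
    · have hyz : y ≠ z := fun h => hz (h ▸ hy)
      rw [Set.indicator_apply, Set.indicator_apply, Config.insert_points,
        Set.mem_insert_iff, or_iff_right hyz, insert_mem_voidEvent_explored hz,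
        ih y z _ S fun h => hz (cone_subset_cone hθ hy h)]
    · simp only [Set.indicator_apply, hy, false_and, if_false, ite_self]

/-- The Mecke equation replaces the sum over the next point by an integral, with that point added to
the configuration. The added point is invisible afterwards: it lies neither in its own explored
region nor in its own cone. The void conditions merge into one for the union of all explored
regions, which is evaluated at the end of the list. -/
theorem lintegral_pathSum (hθ : θ ∈ Set.Ioo 0 (Real.pi / 2)) {lam : ℝ≥0} {Q : Measure Config}
    (hQ : IsPoissonLaw lam Q) (bs : List Bool) :
    ∀ (x : ℂ) {E : Set ℂ} (_ : MeasurableSet E),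
      ∫⁻ S, (voidEvent E).indicator (pathSum θ bs x E) S ∂Q = pathProb θ lam bs x E := by
  classical
  have := hQ.isProbabilityMeasure
  induction bs with
  | nil =>
    intro x E hE
    rw [pathProb, ← hQ.void E hE, ← lintegral_indicator_one (measurableSet_voidEvent hE)]
    rfl
  | cons b bs ih =>
    intro x E hE
    set h : ℂ × Config → ℝ≥0∞ := fun p =>
      (voidEvent E).indicator (fun S => if p.1 ∈ cone θ x ∧ S ∈ voidEvent (explored θ x p.1) ∧
      (volume (cone θ p.1 ∩ (E ∪ explored θ x p.1)) = 0 ↔ b = true)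
      then pathSum θ bs p.1 (E ∪ explored θ x p.1) S else 0) p.2 with hh
    have hmeas : Measurable h := by
      have hE' : MeasurableSet (Prod.snd ⁻¹' E : Set (Unit × ℂ)) := measurable_snd hE
      have hf := measurable_pathSum_term hθ (α := Unit) (x := fun _ => x) measurable_const hE' b
        (measurable_pathSum hθ bs)
      have hg := hf.comp (f := fun p : ℂ × Config => (((), p.2), p.1)) (by fun_prop)
      have := hg.indicator (measurable_snd (α := ℂ) (measurableSet_voidEvent hE))
      exact this
    have e1 : ∀ S, (voidEvent E).indicator (pathSum θ (b :: bs) x E) S =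
        ∫⁻ y, h (y, S) ∂pointKernel S := by
      intro S
      by_cases hS : S ∈ voidEvent E
      · simp only [hh, Set.indicator_of_mem hS]
        rfl
      · simp only [hh, Set.indicator_of_notMem hS, lintegral_zero]
    rw [lintegral_congr e1, hQ.mecke h hmeas, pathProb]
    congr 1
    refine lintegral_congr fun y => ?_
    by_cases hc : y ∈ cone θ x ∧ y ∉ E ∧
      (volume (cone θ y ∩ (E ∪ explored θ x y)) = 0 ↔ b = true)
    · rw [if_pos hc, ← ih y (hE.union (measurableSet_explored hθ x y))]
      refine lintegral_congr fun S => ?_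
      have e2 : S.insert y ∈ voidEvent E ↔ S ∈ voidEvent E := by
        rw [insert_mem_voidEvent, and_iff_right hc.2.1]
      have e3 : S.insert y ∈ voidEvent (explored θ x y) ↔ S ∈ voidEvent (explored θ x y) := by
        rw [insert_mem_voidEvent, and_iff_right (notMem_explored_self θ x y)]
      simp only [hh, Set.indicator_apply, ← voidEvent_inter, Set.mem_inter_iff, e2, e3, hc.1,
        hc.2.2, true_and, and_true, pathSum_insert hθ bs y y _ S (notMem_cone_self θ y)]
      rw [ite_and]
    · rw [if_neg hc]
      refine (lintegral_congr fun S => ?_).trans lintegral_zero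
      simp only [hh, Set.indicator_apply, insert_mem_voidEvent]
      split_ifs with h1 h2
      · exact absurd ⟨h2.1, h1.1, h2.2.2⟩ hc
      · rfl
      · rfl

end PathSums

/-! ### Almost surely, successors exist and are unique -/

section AlmostSurePaths

variable {θ : ℝ}

/-- `y` is the only point of `S` in the cone at `x` that is closest to `x`. -/
def IsStrictSuccessor (θ : ℝ) (S : Set ℂ) (x y : ℂ) : Prop :=
  y ∈ S ∩ cone θ x ∧ ∀ u ∈ S ∩ cone θ x, u ≠ y → ‖y - x‖ < ‖u - x‖

theorem IsStrictSuccessor.successor_eq {S : Set ℂ} {x y : ℂ} (h : IsStrictSuccessor θ S x y) :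
    successor θ S x = y := by
  have hex : ∃ w, IsSuccessor θ S x w := by
    refine ⟨y, h.1, fun u hu => ?_⟩
    by_cases huy : u = y
    · rw [huy]
    · exact (h.2 u hu huy).le
  rw [successor, dif_pos hex]
  by_contra hne
  have hs := hex.choose_spec
  exact absurd (hs.2 y h.1) (not_le.2 (h.2 _ hs.1 hne))

theorem IsStrictSuccessor.mem_voidEvent {S : Config} {x y : ℂ}
    (h : IsStrictSuccessor θ S.points x y) : S ∈ voidEvent (explored θ x y) := by
  refine Set.eq_empty_iff_forall_notMem.2 ?_
  rintro u ⟨huS, hux, hur⟩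
  rw [Metric.mem_ball, dist_eq_norm] at hur
  by_cases huy : u = y
  · rw [huy] at hur
    exact lt_irrefl _ hur
  · exact lt_asymm hur (h.2 u ⟨huS, hux⟩ huy)

theorem IsStrictSuccessor.notMem_voidEvent {S : Config} {x y u : ℂ}
    (h : IsStrictSuccessor θ S.points x y) (hu : u ∈ S.points) (hux : u ∈ cone θ x)
    (huy : u ≠ y) : S ∉ voidEvent (explored θ x u) := by
  intro hv
  refine Set.notMem_empty y (hv ▸ ⟨h.1.1, h.1.2, ?_⟩)
  rw [Metric.mem_ball, dist_eq_norm]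
  exact h.2 u ⟨hu, hux⟩ huy

open Classical in
-- Any other point of the cone has the strict successor in its explored region, so the sum has a
-- single nonzero term.
theorem pathSum_cons_of_isStrictSuccessor {S : Config} {x y : ℂ}
    (h : IsStrictSuccessor θ S.points x y) (b : Bool) (bs : List Bool) (E : Set ℂ) :
    pathSum θ (b :: bs) x E S =
      if (volume (cone θ y ∩ (E ∪ explored θ x y)) = 0 ↔ b = true)
      then pathSum θ bs y (E ∪ explored θ x y) S else 0 := by
  rw [pathSum, lintegral_pointKernel_eq_single h.1.1]
  · simp only [h.1.2, h.mem_voidEvent, true_and]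
  · intro u hu huy
    refine if_neg ?_
    rintro ⟨hux, hv, -⟩
    exact h.notMem_voidEvent hu hux huy hv

/-- The other points of the cone at `x` that are as far from `x` as `y`. -/
def tieSet (θ : ℝ) (x y : ℂ) : Set ℂ := {z | z ∈ cone θ x ∧ ‖z - x‖ = ‖y - x‖ ∧ z ≠ y}

open Classical in
/-- The sum of a function over the closest points of the cone at `x`. -/
noncomputable def stepSum (θ : ℝ) (f : ℂ → Config → ℝ≥0∞) (x : ℂ) (S : Config) : ℝ≥0∞ :=
  ∫⁻ y, (if y ∈ cone θ x ∧ S ∈ voidEvent (explored θ x y) then f y S else 0) ∂pointKernel S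

open Classical in
/-- Vanishes unless there is no point in the cone at `x`, or two closest ones. -/
noncomputable def badSuccessor (θ : ℝ) (x : ℂ) (S : Config) : ℝ≥0∞ :=
  (if S ∈ voidEvent (cone θ x) then 1 else 0) +
    ∫⁻ y, (if y ∈ cone θ x ∧ S ∉ voidEvent (tieSet θ x y) then 1 else 0) ∂pointKernel S

theorem exists_isStrictSuccessor {x : ℂ} {S : Config}
    (hb : badSuccessor θ x S = 0) : ∃ y, IsStrictSuccessor θ S.points x y := by
  classical
  rw [badSuccessor, add_eq_zero] at hb
  obtain ⟨h1, h2⟩ := hb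
  have hne : (S.points ∩ cone θ x).Nonempty := by
    rw [Set.nonempty_iff_ne_empty]
    intro h
    rw [if_pos (show S ∈ voidEvent (cone θ x) from h)] at h1
    exact one_ne_zero h1
  obtain ⟨w, hw⟩ := hne
  have hfin : (S.points ∩ cone θ x ∩ Metric.closedBall x ‖w - x‖).Finite := by
    obtain ⟨n, hn⟩ := exists_nat_gt (‖x‖ + ‖w - x‖)
    refine (S.finite_inter_ball n).subset ?_
    rintro z ⟨⟨hz, -⟩, hzb⟩
    refine ⟨hz, ?_⟩
    rw [Metric.mem_closedBall, dist_eq_norm] at hzb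
    rw [mem_ball_zero_iff]
    calc ‖z‖ = ‖x + (z - x)‖ := by ring_nf
      _ ≤ ‖x‖ + ‖z - x‖ := norm_add_le _ _
      _ < n := by linarith
  obtain ⟨y, hy, hmin⟩ := Set.exists_min_image _ (fun z => ‖z - x‖) hfin
    ⟨w, hw, by rw [Metric.mem_closedBall, dist_eq_norm]⟩
  refine ⟨y, hy.1, fun u hu huy => ?_⟩
  have hle : ‖y - x‖ ≤ ‖u - x‖ := by
    by_cases hub : u ∈ Metric.closedBall x ‖w - x‖
    · exact hmin u ⟨hu, hub⟩
    · rw [Metric.mem_closedBall, dist_eq_norm, not_le] at hub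
      exact (hmin w ⟨hw, by rw [Metric.mem_closedBall, dist_eq_norm]⟩).trans hub.le
  refine lt_of_le_of_ne hle fun heq => ?_
  have h3 := (le_lintegral_pointKernel (f := fun y =>
    if y ∈ cone θ x ∧ S ∉ voidEvent (tieSet θ x y) then (1 : ℝ≥0∞) else 0) hy.1.1).trans_eq h2
  have htie : S ∉ voidEvent (tieSet θ x y) := fun hv =>
    Set.notMem_empty u (hv ▸ ⟨hu.1, hu.2, heq.symm, huy⟩)
  rw [if_pos ⟨hy.1.2, htie⟩] at h3
  exact one_ne_zero (le_antisymm h3 zero_le)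

theorem measurableSet_tieSet_prod (hθ : θ ∈ Set.Ioo 0 (Real.pi / 2)) :
    MeasurableSet {p : (ℂ × ℂ) × ℂ | p.2 ∈ tieSet θ p.1.1 p.1.2} := by
  have h1 : MeasurableSet {p : (ℂ × ℂ) × ℂ | p.2 ∈ cone θ p.1.1} :=
    (measurableSet_cone_prod hθ).preimage (f := fun p : (ℂ × ℂ) × ℂ => (p.1.1, p.2)) (by fun_prop)
  have h2 : MeasurableSet {p : (ℂ × ℂ) × ℂ | ‖p.2 - p.1.1‖ = ‖p.1.2 - p.1.1‖} :=
    measurableSet_eq_fun (by fun_prop) (by fun_prop)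
  have h3 : MeasurableSet {p : (ℂ × ℂ) × ℂ | p.2 ≠ p.1.2} :=
    (measurableSet_eq_fun measurable_snd measurable_fst.snd).compl
  exact h1.inter (h2.inter h3)

theorem volume_tieSet (θ : ℝ) (x y : ℂ) : volume (tieSet θ x y) = 0 := by
  refine measure_mono_null ?_ (Measure.addHaar_sphere volume x ‖y - x‖)
  intro z hz
  rw [mem_sphere_iff_norm]
  exact hz.2.1

theorem measurable_badSuccessor (hθ : θ ∈ Set.Ioo 0 (Real.pi / 2)) :
    Measurable (Function.uncurry (badSuccessor θ)) := by
  classical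
  refine Measurable.add ?_ ?_
  · exact Measurable.ite (measurableSet_inter_eq_empty (measurableSet_cone_prod hθ))
      measurable_const measurable_const
  · refine measurable_lintegral_pointKernel (α := ℂ) (f := fun p y =>
      if y ∈ cone θ p.1 ∧ p.2 ∉ voidEvent (tieSet θ p.1 y) then (1 : ℝ≥0∞) else 0) ?_
    refine Measurable.ite ((measurableSet_mem_cone hθ measurable_id).inter ?_)
      measurable_const measurable_const
    exact (((measurableSet_inter_eq_empty (measurableSet_tieSet_prod hθ))).preimage
      (f := fun q : (ℂ × Config) × ℂ => ((q.1.1, q.2), q.1.2)) (by fun_prop)).compl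

theorem measurable_stepSum (hθ : θ ∈ Set.Ioo 0 (Real.pi / 2)) {f : ℂ → Config → ℝ≥0∞}
    (hf : Measurable (Function.uncurry f)) : Measurable (Function.uncurry (stepSum θ f)) := by
  classical
  refine measurable_lintegral_pointKernel (α := ℂ) (f := fun p y =>
      if y ∈ cone θ p.1 ∧ p.2 ∈ voidEvent (explored θ p.1 y) then f y p.2 else 0) ?_
  refine Measurable.ite ((measurableSet_mem_cone hθ measurable_id).inter
    (measurableSet_void_explored hθ measurable_id)) ?_ measurable_const
  exact hf.comp (f := fun q : (ℂ × Config) × ℂ => (q.2, q.1.2)) (by fun_prop)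

theorem measurable_stepSum_iterate (hθ : θ ∈ Set.Ioo 0 (Real.pi / 2)) (n : ℕ) :
    Measurable (Function.uncurry ((stepSum θ)^[n] (badSuccessor θ))) := by
  induction n with
  | zero => exact measurable_badSuccessor hθ
  | succ n ih =>
    rw [Function.iterate_succ_apply']
    exact measurable_stepSum hθ ih

theorem badSuccessor_insert {x z : ℂ} (hz : z ∉ cone θ x) (S : Config) :
    badSuccessor θ x (S.insert z) = badSuccessor θ x S := by
  classical
  rw [badSuccessor, badSuccessor, insert_mem_voidEvent, and_iff_right hz]
  congr 1
  refine lintegral_pointKernel_congr ?_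
  ext y
  by_cases hy : y ∈ cone θ x
  · have hyz : y ≠ z := fun h => hz (h ▸ hy)
    rw [Set.indicator_apply, Set.indicator_apply, Config.insert_points,
      Set.mem_insert_iff, or_iff_right hyz, insert_mem_voidEvent,
      and_iff_right fun h : z ∈ tieSet θ x y => hz h.1]
  · simp only [Set.indicator_apply, hy, false_and, if_false, ite_self]

theorem stepSum_insert (hθ : θ ∈ Set.Ioo 0 (Real.pi / 2)) {f : ℂ → Config → ℝ≥0∞}
    (hf : ∀ x z S, z ∉ cone θ x → f x (S.insert z) = f x S) (x z : ℂ) (S : Config)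
    (hz : z ∉ cone θ x) : stepSum θ f x (S.insert z) = stepSum θ f x S := by
  classical
  refine lintegral_pointKernel_congr ?_
  ext y
  by_cases hy : y ∈ cone θ x
  · have hyz : y ≠ z := fun h => hz (h ▸ hy)
    rw [Set.indicator_apply, Set.indicator_apply, Config.insert_points,
      Set.mem_insert_iff, or_iff_right hyz, insert_mem_voidEvent_explored hz,
      hf y z S fun h => hz (cone_subset_cone hθ hy h)]
  · simp only [Set.indicator_apply, hy, false_and, if_false, ite_self]

theorem stepSum_iterate_insert (hθ : θ ∈ Set.Ioo 0 (Real.pi / 2)) (n : ℕ) :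
    ∀ x z S, z ∉ cone θ x → (stepSum θ)^[n] (badSuccessor θ) x (S.insert z) =
      (stepSum θ)^[n] (badSuccessor θ) x S := by
  induction n with
  | zero => exact fun x z S hz => badSuccessor_insert hz S
  | succ n ih =>
    rw [Function.iterate_succ_apply']
    exact stepSum_insert hθ ih

/-- An empty cone has probability 0 because the cone has infinite area. For ties, the Mecke equation
reduces the claim to the void probability of a subset of a circle, which has area 0. -/
theorem lintegral_badSuccessor (hθ : θ ∈ Set.Ioo 0 (Real.pi / 2)) {lam : ℝ≥0} (hlam : 0 < lam)
    {Q : Measure Config} (hQ : IsPoissonLaw lam Q) (x : ℂ) :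
    ∫⁻ S, badSuccessor θ x S ∂Q = 0 := by
  classical
  have := hQ.isProbabilityMeasure
  have hl : (lam : ℝ≥0∞) ≠ 0 := by exact_mod_cast hlam.ne'
  have hvm := measurableSet_voidEvent (measurableSet_cone hθ x)
  unfold badSuccessor
  rw [lintegral_add_left (f := fun S => if S ∈ voidEvent (cone θ x) then (1 : ℝ≥0∞) else 0)
    (Measurable.ite hvm measurable_const measurable_const)]
  have e1 : ∫⁻ S, (if S ∈ voidEvent (cone θ x) then (1 : ℝ≥0∞) else 0) ∂Q = 0 := by
    have : ∀ S, (if S ∈ voidEvent (cone θ x) then (1 : ℝ≥0∞) else 0) =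
        (voidEvent (cone θ x)).indicator 1 S := fun S => by simp [Set.indicator_apply]
    simp only [this]
    rw [lintegral_indicator_one hvm, hQ.void _ (measurableSet_cone hθ x),
      volume_cone_eq_top hθ, ENNReal.mul_top hl, expNeg_top]
  have htie : MeasurableSet {p : ℂ × ℂ | p.2 ∈ tieSet θ x p.1} :=
    (measurableSet_tieSet_prod hθ).preimage (f := fun p : ℂ × ℂ => ((x, p.1), p.2)) (by fun_prop)
  have hmeas : Measurable fun p : ℂ × Config =>
      if p.1 ∈ cone θ x ∧ p.2 ∉ voidEvent (tieSet θ x p.1) then (1 : ℝ≥0∞) else 0 :=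
    Measurable.ite ((measurable_fst (measurableSet_cone hθ x)).inter
      (measurableSet_inter_eq_empty htie).compl) measurable_const measurable_const
  have hm := hQ.mecke _ hmeas
  rw [e1, zero_add, hm]
  refine mul_eq_zero_of_right _ ((lintegral_congr fun y => ?_).trans lintegral_zero)
  have htm : MeasurableSet (tieSet θ x y) := measurable_prodMk_left htie
  rw [lintegral_eq_zero_iff]
  · have h0 : Q (voidEvent (tieSet θ x y))ᶜ = 0 := by
      rw [prob_compl_eq_zero_iff (measurableSet_voidEvent htm), hQ.void _ htm, volume_tieSet,
        mul_zero, expNeg_zero]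
    filter_upwards [compl_mem_ae_iff.2 h0] with S hS
    rw [compl_compl] at hS
    refine if_neg fun h => h.2 ?_
    exact insert_mem_voidEvent.2 ⟨fun h' => h'.2.2 rfl, hS⟩
  · exact hmeas.comp (measurable_const.prodMk
      (measurable_insert.comp (measurable_prodMk_left (x := y))))

/-- Once the void condition is dropped, `stepSum` is at most a sum over all points. By the Mecke
equation its mean is an integral of means that vanish by induction, since adding y does not affect
the path from y. So no waypoint has a bad successor, although waypoints are random. -/
theorem lintegral_stepSum_iterate (hθ : θ ∈ Set.Ioo 0 (Real.pi / 2)) {lam : ℝ≥0} (hlam : 0 < lam)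
    {Q : Measure Config} (hQ : IsPoissonLaw lam Q) (n : ℕ) :
    ∀ x : ℂ, ∫⁻ S, (stepSum θ)^[n] (badSuccessor θ) x S ∂Q = 0 := by
  classical
  induction n with
  | zero => exact lintegral_badSuccessor hθ hlam hQ
  | succ n ih =>
    intro x
    have hm := measurable_stepSum_iterate hθ n
    have hi := stepSum_iterate_insert hθ n
    rw [Function.iterate_succ_apply']
    set f := (stepSum θ)^[n] (badSuccessor θ)
    have hle : ∫⁻ S, stepSum θ f x S ∂Q ≤ ∫⁻ S, ∫⁻ y, f y S ∂pointKernel S ∂Q := by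
      refine lintegral_mono fun S => lintegral_mono fun y => ?_
      dsimp only
      split_ifs
      · exact le_rfl
      · exact zero_le
    refine le_antisymm (hle.trans_eq ?_) zero_le
    rw [hQ.mecke (fun p => f p.1 p.2) hm]
    simp only [fun y S => hi y y S (notMem_cone_self θ y), ih, lintegral_zero, mul_zero]

/-- All navigation paths from `x` have unique successors. -/
def IsRegularAt (θ : ℝ) (x : ℂ) (S : Config) : Prop :=
  ∀ n : ℕ, (stepSum θ)^[n] (badSuccessor θ) x S = 0

theorem ae_isRegularAt (hθ : θ ∈ Set.Ioo 0 (Real.pi / 2)) {lam : ℝ≥0} (hlam : 0 < lam)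
    {Q : Measure Config} (hQ : IsPoissonLaw lam Q) (x : ℂ) : ∀ᵐ S ∂Q, IsRegularAt θ x S := by
  refine ae_all_iff.2 fun n => ?_
  have hm : Measurable ((stepSum θ)^[n] (badSuccessor θ) x) :=
    (measurable_stepSum_iterate hθ n).comp (measurable_prodMk_left (x := x))
  exact (lintegral_eq_zero_iff hm).1 (lintegral_stepSum_iterate hθ hlam hQ n x)

theorem IsRegularAt.exists_isStrictSuccessor {x : ℂ} {S : Config} (h : IsRegularAt θ x S) :
    ∃ y, IsStrictSuccessor θ S.points x y ∧ IsRegularAt θ y S := by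
  classical
  obtain ⟨y, hy⟩ := DirectedNavigation.exists_isStrictSuccessor (h 0)
  refine ⟨y, hy, fun n => ?_⟩
  have h1 := h (n + 1)
  rw [Function.iterate_succ_apply'] at h1
  have h2 := (le_lintegral_pointKernel (f := fun y =>
    if y ∈ cone θ x ∧ S ∈ voidEvent (explored θ x y)
    then (stepSum θ)^[n] (badSuccessor θ) y S else 0) hy.1.1).trans_eq h1
  rw [if_pos ⟨hy.1.2, hy.mem_voidEvent⟩] at h2
  exact le_antisymm h2 zero_le

/-- The sequence of events `p n, p (n + 1), …` follows the pattern of the list. -/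
def Matches (p : ℕ → Prop) : ℕ → List Bool → Prop
  | _, [] => True
  | n, b :: bs => (p n ↔ b = true) ∧ Matches p (n + 1) bs

open Classical in
-- The invariant is that the history is the part of E in the current cone. The history is cut down
-- to the cone at every step and E never is; as the cones are nested, both leave the same set in the
-- next cone.
theorem pathSum_waypoint (hθ : θ ∈ Set.Ioo 0 (Real.pi / 2)) {S : Config} (bs : List Bool) :
    ∀ (k : ℕ) (E : Set ℂ), IsRegularAt θ (waypoint θ S.points k) S →
      IsHistory θ (waypoint θ S.points k) E →
      history θ S.points k = cone θ (waypoint θ S.points k) ∩ E →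
      pathSum θ bs (waypoint θ S.points k) E S =
        if Matches (fun n => history θ S.points n = ∅) (k + 1) bs then 1 else 0 := by
  induction bs with
  | nil => intro k E _ _ _; simp [pathSum, Matches]
  | cons b bs ih =>
    intro k E hreg hE hhist
    obtain ⟨y, hy, hyreg⟩ := hreg.exists_isStrictSuccessor
    have hw : waypoint θ S.points (k + 1) = y := hy.successor_eq
    have hE' := hE.union_explored hθ hy.1.2
    have hhist' : history θ S.points (k + 1) =
        cone θ y ∩ (E ∪ explored θ (waypoint θ S.points k) y) := by
      have hsub := cone_subset_cone hθ hy.1.2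
      rw [history, hhist, progress, Nat.add_sub_cancel, hw]
      ext z
      simp only [Set.mem_inter_iff, Set.mem_union, explored]
      constructor
      · rintro ⟨hz, ⟨-, hzE⟩ | hzb⟩
        · exact ⟨hz, Or.inl hzE⟩
        · exact ⟨hz, Or.inr ⟨hsub hz, hzb⟩⟩
      · rintro ⟨hz, hzE | ⟨-, hzb⟩⟩
        · exact ⟨hz, Or.inl ⟨hsub hz, hzE⟩⟩
        · exact ⟨hz, Or.inr hzb⟩
    have hiff : volume (cone θ y ∩ (E ∪ explored θ (waypoint θ S.points k) y)) = 0 ↔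
        history θ S.points (k + 1) = ∅ := by rw [hE'.volume_eq_zero_iff hθ, hhist']
    rw [pathSum_cons_of_isStrictSuccessor hy]
    have := ih (k + 1) (E ∪ explored θ (waypoint θ S.points k) y) (by rwa [hw]) (by rwa [hw])
      (by rw [hw, hhist'])
    rw [hw] at this
    by_cases h1 : history θ S.points (k + 1) = ∅ ↔ b = true
    · by_cases h2 : Matches (fun n => history θ S.points n = ∅) (k + 1 + 1) bs
      · rw [if_pos (hiff.trans h1), this, if_pos h2, if_pos ⟨h1, h2⟩]
      · rw [if_pos (hiff.trans h1), this, if_neg h2, if_neg fun h => h2 h.2]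
    · rw [if_neg fun h => h1 (hiff.symm.trans h), if_neg fun h => h1 h.1]

/-- A single event of the sequence becomes a countable union of finite patterns, whose indicators
are measurable path sums. -/
theorem exists_matches_append_true (p : ℕ → Prop) (m : ℕ) :
    ∀ k, (∃ bs : List Bool, bs.length = m ∧ Matches p k (bs ++ [true])) ↔ p (k + m) := by
  classical
  induction m with
  | zero =>
    intro k
    constructor
    · rintro ⟨bs, h, hm⟩
      rw [List.length_eq_zero_iff] at h
      subst h
      simpa [Matches] using hm
    · intro h
      exact ⟨[], rfl, by simpa [Matches] using h⟩
  | succ m ih =>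
    intro k
    rw [show k + (m + 1) = k + 1 + m by ring, ← ih (k + 1)]
    constructor
    · rintro ⟨_ | ⟨b, bs⟩, h, hm⟩
      · simp at h
      · exact ⟨bs, by simpa using h, hm.2⟩
    · rintro ⟨bs, h, hm⟩
      exact ⟨decide (p k) :: bs, by simpa using h, by simp, hm⟩

theorem Matches.congr {p q : ℕ → Prop} (h : ∀ n, p n ↔ q n) (bs : List Bool) :
    ∀ n, Matches p n bs ↔ Matches q n bs := by
  induction bs with
  | nil => exact fun _ => Iff.rfl
  | cons b bs ih => exact fun n => and_congr (by rw [h n]) (ih _)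

/-- The law of the pattern of renewals. -/
theorem measure_matches {Ω : Type*} [MeasurableSpace Ω] {μ : Measure Ω} [IsProbabilityMeasure μ]
    {lam : ℝ≥0} {P : Ω → Set ℂ} (hθ : θ ∈ Set.Ioo 0 (Real.pi / 2)) (hlam : 0 < lam)
    (hP : IsPoissonProcess μ lam P) :
    ∃ X : ℕ → Ω → Prop, (∀ n, MeasurableSet {ω | X n ω}) ∧
      (∀ᵐ ω ∂μ, ∀ n, X n ω ↔ history θ (P ω) n = ∅) ∧
      ∀ bs : List Bool, μ {ω | Matches (fun n => X n ω) 1 bs} = pathProb θ lam bs 0 ∅ := by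
  classical
  have hQ := hP.isPoissonLaw hlam
  have hm := hP.measurable_toConfig
  have hps : ∀ bs, Measurable (pathSum θ bs 0 ∅) := fun bs =>
    measurable_pathSum_const hθ bs 0 MeasurableSet.empty
  have hae : ∀ᵐ ω ∂μ, ∀ bs, pathSum θ bs 0 ∅ (toConfig (P ω)) =
      if Matches (fun n => history θ (P ω) n = ∅) 1 bs then 1 else 0 := by
    filter_upwards [hP.toConfig_ae_eq, ae_of_ae_map hm.aemeasurable (ae_isRegularAt hθ hlam hQ 0)]
      with ω hω hreg bs
    have := pathSum_waypoint hθ bs 0 ∅ hreg (isHistory_empty _ _) (by simp [history])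
    rwa [hω] at this
  have hXae : ∀ᵐ ω ∂μ, ∀ n, (n = 0 ∨ ∃ bs : List Bool, bs.length + 1 = n ∧
      pathSum θ (bs ++ [true]) 0 ∅ (toConfig (P ω)) = 1) ↔ history θ (P ω) n = ∅ := by
    filter_upwards [hae] with ω hω n
    have e : ∀ bs, pathSum θ (bs ++ [true]) 0 ∅ (toConfig (P ω)) = 1 ↔
        Matches (fun n => history θ (P ω) n = ∅) 1 (bs ++ [true]) := fun bs => by
      rw [hω]
      split_ifs with h <;> simp [h]
    simp only [e]
    rcases n with _ | n
    · simp [history]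
    · have := exists_matches_append_true (fun n => history θ (P ω) n = ∅) n 1
      rw [add_comm 1 n] at this
      simpa using this
  -- The renewal events themselves need not be measurable in ω, so they are replaced by almost
  -- surely equal ones, defined through path sums. Step 0 counts as a renewal because `history` is
  -- empty there.
  refine ⟨fun n ω => n = 0 ∨ ∃ bs : List Bool, bs.length + 1 = n ∧
      pathSum θ (bs ++ [true]) 0 ∅ (toConfig (P ω)) = 1, fun n => ?_, hXae, fun bs => ?_⟩
  · refine MeasurableSet.union (MeasurableSet.const _) ?_
    have : {ω | ∃ bs : List Bool, bs.length + 1 = n ∧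
        pathSum θ (bs ++ [true]) 0 ∅ (toConfig (P ω)) = 1} =
        ⋃ bs : List Bool, ⋃ _ : bs.length + 1 = n,
          (fun ω => pathSum θ (bs ++ [true]) 0 ∅ (toConfig (P ω))) ⁻¹' {1} := by
      ext ω
      simp
    change MeasurableSet {ω | ∃ bs : List Bool, bs.length + 1 = n ∧
        pathSum θ (bs ++ [true]) 0 ∅ (toConfig (P ω)) = 1}
    rw [this]
    exact MeasurableSet.iUnion fun bs => MeasurableSet.iUnion fun _ =>
      ((hps _).comp hm) (measurableSet_singleton 1)
  · rw [← lintegral_pathSum hθ hQ bs 0 MeasurableSet.empty,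
      lintegral_map ((hps bs).indicator (measurableSet_voidEvent MeasurableSet.empty)) hm]
    have hset : MeasurableSet {ω | pathSum θ bs 0 ∅ (toConfig (P ω)) = 1} :=
      ((hps bs).comp hm) (measurableSet_singleton 1)
    calc _ = μ {ω | pathSum θ bs 0 ∅ (toConfig (P ω)) = 1} := by
          refine measure_congr ?_
          filter_upwards [hae, hXae] with ω hω hX
          refine propext ((Matches.congr hX bs 1).trans ?_)
          change _ ↔ pathSum θ bs 0 ∅ (toConfig (P ω)) = 1
          rw [hω]
          split_ifs with h <;> simp [h]
      _ = _ := by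
          rw [← lintegral_indicator_one hset]
          refine lintegral_congr_ae ?_
          filter_upwards [hae] with ω hω
          have hv : toConfig (P ω) ∈ voidEvent ∅ := by simp [voidEvent]
          rw [Set.indicator_of_mem hv]
          have h := hω bs
          by_cases hM : Matches (fun n => history θ (P ω) n = ∅) 1 bs
          · rw [if_pos hM] at h
            rw [Set.indicator_of_mem (show ω ∈ {ω | pathSum θ bs 0 ∅ (toConfig (P ω)) = 1} from h),
              h, Pi.one_apply]
          · rw [if_neg hM] at h
            rw [h, Set.indicator_of_notMem]
            change ¬ (pathSum θ bs 0 ∅ (toConfig (P ω)) = 1)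
            rw [h]
            exact zero_ne_one

end AlmostSurePaths

/-! ### Renewal factorization, translation and scaling of path probabilities -/

section Renewal

variable {θ : ℝ} {lam : ℝ≥0}

theorem volume_union_null_inter {A B C : Set ℂ} (h : volume (C ∩ B) = 0) :
    volume (C ∩ (A ∪ B)) = 0 ↔ volume (C ∩ A) = 0 := by
  rw [Set.inter_union_distrib_left, measure_union_null_iff, and_iff_left h]

/-- An explored region outside the cone is irrelevant for the future path. -/
theorem pathProb_union_of_null (hθ : θ ∈ Set.Ioo 0 (Real.pi / 2)) {Z : Set ℂ}
    (hZ : MeasurableSet Z) (bs : List Bool) :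
    ∀ (x : ℂ) (E : Set ℂ), MeasurableSet E → volume (cone θ x ∩ Z) = 0 →
      pathProb θ lam bs x (E ∪ Z) = expNeg (lam * volume (Z \ E)) * pathProb θ lam bs x E := by
  classical
  induction bs with
  | nil =>
    intro x E hE hxZ
    rw [pathProb, pathProb, ← expNeg_add, ← mul_add, add_comm,
      ← measure_union Set.disjoint_sdiff_right (hZ.diff hE), Set.union_sdiff_self]
  | cons b bs ih =>
    intro x E hE hxZ
    rw [pathProb, pathProb, mul_left_comm, ← lintegral_const_mul' _ _ (expNeg_ne_top _)]
    congr 1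
    refine lintegral_congr_ae ?_
    have hae : ∀ᵐ y, y ∉ cone θ x ∩ Z := compl_mem_ae_iff.2 hxZ
    filter_upwards [hae] with y hy
    by_cases hyx : y ∈ cone θ x
    · have hyZ : y ∉ Z := fun h => hy ⟨hyx, h⟩
      have hn : volume (cone θ y ∩ Z) = 0 := measure_mono_null
        (Set.inter_subset_inter_left _ (cone_subset_cone hθ hyx)) hxZ
      have hun : E ∪ Z ∪ explored θ x y = E ∪ explored θ x y ∪ Z := Set.union_right_comm _ _ _
      -- The new explored region lies in the cone at x, which meets Z in a null set.
      have hdiff : volume (Z \ (E ∪ explored θ x y)) = volume (Z \ E) := by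
        rw [← Set.sdiff_sdiff]
        refine measure_sdiff_null' (measure_mono_null ?_ hxZ)
        exact fun z hz => ⟨hz.2.1, hz.1.1⟩
      rw [hun, ih y _ (hE.union (measurableSet_explored hθ x y)) hn, hdiff]
      simp only [Set.mem_union, hyZ, or_false, volume_union_null_inter hn]
      split_ifs <;> simp
    · simp [hyx]

/-- Affine maps change the intensity only. -/
theorem pathProb_affine {a : ℂ} {s : ℝ} (hs : 0 < s) {lam' : ℝ≥0}
    (hl : (lam' : ℝ) = lam * s ^ 2) (bs : List Bool) :
    ∀ (x : ℂ) (E : Set ℂ),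
      pathProb θ lam bs (a + s • x) E =
        pathProb θ lam' bs x ((fun w : ℂ => a + s • w) ⁻¹' E) := by
  classical
  set e : ℂ ≃ᵐ ℂ := ((Homeomorph.smulOfNeZero s hs.ne').trans
    (Homeomorph.addLeft a)).toMeasurableEquiv with he
  have hecoe : ∀ w, e w = a + s • w := fun w => rfl
  have hmap : Measure.map e volume = ENNReal.ofReal ((s ^ 2)⁻¹) • (volume : Measure ℂ) := by
    have h1 : (e : ℂ → ℂ) = (fun w => a + w) ∘ fun w => s • w := rfl
    rw [h1, ← Measure.map_map (by fun_prop) (by fun_prop), Measure.map_addHaar_smul _ hs.ne',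
      Measure.map_smul, map_add_left_eq_self, Complex.finrank_real_complex,
      abs_of_pos (by positivity)]
  -- The Jacobian of the map is exactly compensated by the change of intensity.
  have hll : (lam' : ℝ≥0∞) * ENNReal.ofReal ((s ^ 2)⁻¹) = lam := by
    rw [← ENNReal.ofReal_coe_nnreal, ← ENNReal.ofReal_mul (by positivity), hl,
      mul_assoc, mul_inv_cancel₀ (by positivity), mul_one, ENNReal.ofReal_coe_nnreal]
  have hvol : ∀ A : Set ℂ, volume (e ⁻¹' A) = ENNReal.ofReal ((s ^ 2)⁻¹) * volume A := by
    intro A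
    rw [← MeasurableEquiv.map_apply, hmap, Measure.smul_apply, smul_eq_mul]
  have hvol0 : ∀ A : Set ℂ, volume (e ⁻¹' A) = 0 ↔ volume A = 0 := by
    intro A
    rw [hvol, mul_eq_zero, or_iff_right]
    rw [ENNReal.ofReal_eq_zero, not_le]
    positivity
  have hsub : ∀ v w, e w - e v = s * (w - v) := fun v w => by
    simp only [hecoe, Complex.real_smul]; ring
  have hcone : ∀ v w, e w ∈ cone θ (e v) ↔ w ∈ cone θ v := by
    intro v w
    simp only [cone, Set.mem_ofPred_eq, hsub, norm_mul, Complex.norm_real,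
      Real.norm_of_nonneg hs.le, Complex.arg_real_mul _ hs, mul_pos_iff_of_pos_left hs]
  have hexp : ∀ v w, e ⁻¹' explored θ (e v) (e w) = explored θ v w := by
    intro v w
    ext z
    simp only [explored, Set.mem_preimage, Set.mem_inter_iff, hcone, Metric.mem_ball, dist_eq_norm,
      hsub, norm_mul, Complex.norm_real, Real.norm_of_nonneg hs.le, mul_lt_mul_iff_right₀ hs]
  have hpc : ∀ v, e ⁻¹' cone θ (e v) = cone θ v := fun v => Set.ext fun w => hcone v w
  change ∀ (x : ℂ) (E : Set ℂ), pathProb θ lam bs (e x) E = pathProb θ lam' bs x (e ⁻¹' E)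
  induction bs with
  | nil =>
    intro x E
    rw [pathProb, pathProb, hvol, ← mul_assoc, hll]
  | cons b bs ih =>
    intro x E
    rw [pathProb, pathProb, ← hll, mul_assoc, ← smul_eq_mul (ENNReal.ofReal _),
      ← lintegral_smul_measure, ← hmap, lintegral_map_equiv]
    congr 1
    refine lintegral_congr fun y => ?_
    rw [ih, Set.preimage_union, hexp]
    have h0 : volume (cone θ (e y) ∩ (E ∪ explored θ (e x) (e y))) = 0 ↔
        volume (cone θ y ∩ (e ⁻¹' E ∪ explored θ x y)) = 0 := by
      rw [← hvol0, Set.preimage_inter, Set.preimage_union, hexp, hpc]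
    simp only [hcone, h0, Set.mem_preimage]

theorem pathProb_translate (bs : List Bool) (x : ℂ) :
    pathProb θ lam bs x ∅ = pathProb θ lam bs 0 ∅ := by
  have := pathProb_affine (θ := θ) (lam := lam) (lam' := lam) (a := x) one_pos (by simp) bs 0 ∅
  simpa using this

/-- At the renewal everything explored is a null set within the cone at y, so by
`pathProb_union_of_null` it only contributes its void probability. That factor closes the first
list, and the remaining path starts afresh at y, which may be moved to the origin. Finiteness of the
second factor allows it to be taken out of the integral. -/
theorem pathProb_append_true_cons (hθ : θ ∈ Set.Ioo 0 (Real.pi / 2)) {cs : List Bool}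
    (hcs : pathProb θ lam cs 0 ∅ ≠ ∞) (bs : List Bool) :
    ∀ (x : ℂ) (E : Set ℂ), MeasurableSet E →
      pathProb θ lam (bs ++ true :: cs) x E =
        pathProb θ lam (bs ++ [true]) x E * pathProb θ lam cs 0 ∅ := by
  classical
  induction bs with
  | nil =>
    intro x E hE
    rw [List.nil_append, List.nil_append, pathProb, pathProb, mul_assoc,
      ← lintegral_mul_const' _ _ hcs]
    congr 1
    refine lintegral_congr fun y => ?_
    rw [ite_mul, zero_mul]
    split_ifs with h
    · have hm := hE.union (measurableSet_explored hθ x y)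
      have := pathProb_union_of_null (lam := lam) hθ hm cs y ∅ MeasurableSet.empty (h.2.2.2 rfl)
      rw [Set.empty_union, Set.sdiff_empty, pathProb_translate] at this
      rw [this, pathProb]
    · rfl
  | cons b bs ih =>
    intro x E hE
    rw [List.cons_append, List.cons_append, pathProb, pathProb, mul_assoc,
      ← lintegral_mul_const' _ _ hcs]
    congr 1
    refine lintegral_congr fun y => ?_
    rw [ite_mul, zero_mul, ih y _ (hE.union (measurableSet_explored hθ x y))]

/-- The next point exists. -/
theorem pathProb_true_add_false (hθ : θ ∈ Set.Ioo 0 (Real.pi / 2)) (hlam : 0 < lam)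
    {Q : Measure Config} (hQ : IsPoissonLaw lam Q) (x : ℂ) {E : Set ℂ} (hE : MeasurableSet E) :
    pathProb θ lam [true] x E + pathProb θ lam [false] x E = expNeg (lam * volume E) := by
  classical
  have hv := measurableSet_voidEvent hE
  rw [← lintegral_pathSum hθ hQ _ x hE, ← lintegral_pathSum hθ hQ _ x hE, ← hQ.void E hE,
    ← lintegral_add_left ((measurable_pathSum_const hθ _ x hE).indicator hv),
    ← lintegral_indicator_one hv]
  refine lintegral_congr_ae ?_
  filter_upwards [ae_isRegularAt hθ hlam hQ x] with S hS
  obtain ⟨y, hy, -⟩ := hS.exists_isStrictSuccessor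
  by_cases hSE : S ∈ voidEvent E
  · rw [Set.indicator_of_mem hSE, Set.indicator_of_mem hSE, Set.indicator_of_mem hSE,
      pathSum_cons_of_isStrictSuccessor hy, pathSum_cons_of_isStrictSuccessor hy, Pi.one_apply]
    simp only [pathSum]
    by_cases h : volume (cone θ y ∩ (E ∪ explored θ x y)) = 0 <;> simp [h]
  · simp [Set.indicator_of_notMem hSE]

/-- Scaling transfers the identity from the law of intensity `lam` at hand to intensity 1, so that
no process of intensity 1 has to be constructed. -/
theorem pathProb_one_true_add_false (hθ : θ ∈ Set.Ioo 0 (Real.pi / 2)) (hlam : 0 < lam)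
    {Q : Measure Config} (hQ : IsPoissonLaw lam Q) (x : ℂ) {E : Set ℂ} (hE : MeasurableSet E) :
    pathProb θ 1 [true] x E + pathProb θ 1 [false] x E = expNeg (volume E) := by
  have hlr : (0 : ℝ) < lam := hlam
  set s : ℝ := (Real.sqrt lam)⁻¹ with hs
  have hspos : 0 < s := by positivity
  have hl : ((1 : ℝ≥0) : ℝ) = lam * s ^ 2 := by
    rw [hs, inv_pow, Real.sq_sqrt hlr.le, mul_inv_cancel₀ hlr.ne', NNReal.coe_one]
  set F : Set ℂ := (fun w : ℂ => s⁻¹ • w) ⁻¹' E with hF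
  have hFm : MeasurableSet F := hE.preimage (by fun_prop)
  have hFE : (fun w : ℂ => 0 + s • w) ⁻¹' F = E := by
    ext w
    rw [hF, Set.mem_preimage, Set.mem_preimage, zero_add, smul_smul, inv_mul_cancel₀ hspos.ne',
      one_smul]
  have h := pathProb_true_add_false hθ hlam hQ (0 + s • x) hFm
  have hnil := pathProb_affine (θ := θ) (lam := lam) (a := 0) hspos hl [] x F
  rw [pathProb_affine hspos hl, pathProb_affine hspos hl, hFE] at h
  rw [hFE, pathProb, pathProb, ENNReal.coe_one, one_mul] at hnil
  rw [h, hnil]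

theorem pathProb_scale (hlam : 0 < lam) (bs : List Bool) :
    pathProb θ lam bs 0 ∅ = pathProb θ 1 bs 0 ∅ := by
  have hlr : (0 : ℝ) < lam := hlam
  have hspos : 0 < (Real.sqrt lam)⁻¹ := by positivity
  have hl : ((1 : ℝ≥0) : ℝ) = lam * ((Real.sqrt lam)⁻¹) ^ 2 := by
    rw [inv_pow, Real.sq_sqrt hlr.le, mul_inv_cancel₀ hlr.ne', NNReal.coe_one]
  simpa using pathProb_affine (θ := θ) (lam := lam) (a := 0) hspos hl bs 0 ∅

end Renewal

/-! ### The law of one step and its bounds -/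

section Tail

variable {θ : ℝ}

/-- The constants of the Lyapunov function `A + exp L`. -/
theorem exists_lyapunov_constants {K ρ₀ : ℝ} (hK : 0 ≤ K) (hρ₀ : ρ₀ < 1) (hρ₀' : 0 ≤ ρ₀)
    {q : ℝ → ℝ} (hq : Antitone q) (hqpos : ∀ M, 0 < q M) :
    ∃ ρ A : ℝ, 0 < ρ ∧ ρ < 1 ∧ 1 ≤ A ∧ ∀ L : ℝ,
      A * (1 - q L) + Real.exp L * ρ₀ + K ≤ ρ * (A + Real.exp L) := by
  -- T is the threshold for exp L: above it, the contraction of exp L gains at least 1 + K, which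
  -- pays for K and for the loss A - ρA ≤ 1.
  set T : ℝ := 2 * (1 + K) / (1 - ρ₀) with hT
  have h1 : 0 < 1 - ρ₀ := by linarith
  have hTpos : 0 < T := by positivity
  have hTeq : (1 - ρ₀) / 2 * T = 1 + K := by rw [hT]; field_simp
  have hqM := hqpos (Real.log T)
  set qM := q (Real.log T)
  -- Below the threshold, half of the gain A · qM from a possible renewal pays for exp L ≤ T and K.
  set A : ℝ := max 1 (2 * (T + K) / qM) with hA
  have hA1 : 1 ≤ A := le_max_left _ _
  have hApos : 0 < A := by linarith
  have hA2 : T + K ≤ A * qM / 2 := by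
    have h := le_max_right 1 (2 * (T + K) / qM)
    rw [← hA, div_le_iff₀ hqM] at h
    linarith
  -- The first and the third term serve the case of large exp L, the second the case of small exp L.
  set ρ : ℝ := max ((1 + ρ₀) / 2) (max (1 - qM / 2) (1 - 1 / A)) with hρ
  have hr1 : (1 + ρ₀) / 2 ≤ ρ := le_max_left _ _
  have hr2 : 1 - qM / 2 ≤ ρ := (le_max_left _ _).trans (le_max_right _ _)
  have hr3 : 1 - 1 / A ≤ ρ := (le_max_right _ _).trans (le_max_right _ _)
  have hr3' : A - 1 ≤ ρ * A := by
    have := mul_le_mul_of_nonneg_right hr3 hApos.le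
    rwa [sub_mul, one_mul, one_div, inv_mul_cancel₀ hApos.ne'] at this
  have hρpos : 0 < ρ := by linarith
  refine ⟨ρ, A, hρpos, ?_, hA1, fun L => ?_⟩
  · refine max_lt (by linarith) (max_lt (by linarith) ?_)
    have : 0 < 1 / A := by positivity
    linarith
  · have hE := Real.exp_pos L
    have hqL := hqpos L
    by_cases hL : T ≤ Real.exp L
    · have : (1 - ρ₀) / 2 * T ≤ (ρ - ρ₀) * Real.exp L :=
        mul_le_mul (by linarith) hL hTpos.le (by linarith)
      have h4 : 0 ≤ A * q L := by positivity
      nlinarith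
    · push Not at hL
      have hLM : L ≤ Real.log T := by
        rw [Real.le_log_iff_exp_le hTpos]
        exact hL.le
      have h2 : A * qM ≤ A * q L := mul_le_mul_of_nonneg_left (hq hLM) hApos.le
      have h3 : Real.exp L * ρ₀ ≤ T := by nlinarith
      have h4 : A * (1 - qM / 2) ≤ A * ρ := mul_le_mul_of_nonneg_left hr2 hApos.le
      have h5 : 0 < ρ * Real.exp L := by positivity
      nlinarith

/-- The steps into the narrow cone that go at least `M` to the right. -/
def longNarrowSteps (θ : ℝ) (M : ℝ) : Set ℂ := {u | u ∈ narrowCone θ 0 ∧ M ≤ u.re}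

theorem measurableSet_longNarrowSteps (θ M : ℝ) : MeasurableSet (longNarrowSteps θ M) :=
  (measurableSet_narrowCone θ 0).inter (measurableSet_le measurable_const Complex.measurable_re)

theorem measurable_volume_ball_norm :
    Measurable fun u : ℂ => expNeg (volume (Metric.ball (0 : ℂ) ‖u‖)) := by
  refine measurable_expNeg.comp ?_
  simp only [Complex.volume_ball]
  fun_prop

theorem volume_preimage_sub (x : ℂ) (A : Set ℂ) :
    volume ((fun w => w - x) ⁻¹' A) = volume A := by
  simp only [sub_eq_add_neg]
  exact measure_preimage_add_right volume (-x) A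

/-- A lower bound for the probability of a step in `longNarrowSteps θ M`. -/
noncomputable def longStepMass (θ : ℝ) (M : ℝ) : ℝ :=
  (min 1 (∫⁻ u in longNarrowSteps θ M, expNeg (volume (Metric.ball (0 : ℂ) ‖u‖)))).toReal

theorem longStepMass_antitone (θ : ℝ) : Antitone (longStepMass θ) := by
  intro M M' h
  refine ENNReal.toReal_mono ((min_le_left _ _).trans_lt ENNReal.one_lt_top).ne ?_
  refine min_le_min le_rfl (lintegral_mono_set ?_)
  exact fun u hu => ⟨hu.1, h.trans hu.2⟩

/-- The integrand is positive everywhere and the set of steps contains a nonempty open set. The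
truncation at 1 in the definition keeps the value finite. -/
theorem longStepMass_pos (hθ : θ ∈ Set.Ioo 0 (Real.pi / 2)) (M : ℝ) : 0 < longStepMass θ M := by
  refine ENNReal.toReal_pos ?_ ((min_le_left _ _).trans_lt ENNReal.one_lt_top).ne
  refine (lt_min one_pos ?_).ne'
  rw [setLIntegral_pos_iff measurable_volume_ball_norm]
  have hm := narrowSlope_pos hθ
  have hopen : IsOpen {u : ℂ | max M 0 < u.re ∧ |u.im| < narrowSlope θ * u.re} := by
    rw [Set.ofPred_and]
    refine IsOpen.inter ?_ ?_
    · exact isOpen_lt continuous_const (by fun_prop)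
    · exact isOpen_lt (by fun_prop) (by fun_prop)
  refine (hopen.measure_pos volume ⟨((max M 0 + 1 : ℝ) : ℂ), ?_, ?_⟩).trans_le (measure_mono ?_)
  · rw [Complex.ofReal_re]
    exact lt_add_one _
  · have : 0 < max M 0 + 1 := by linarith [le_max_right M 0]
    rw [Complex.ofReal_im, abs_zero, Complex.ofReal_re]
    positivity
  · rintro u ⟨h1, h2⟩
    have h3 := (le_max_right M 0).trans_lt h1
    refine ⟨expNeg_ne_zero measure_ball_lt_top.ne, ⟨?_, ?_⟩, ((le_max_left M 0).trans_lt h1).le⟩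
    · simpa using h3
    · simpa using h2.le

theorem longStepMass_le_one (θ M : ℝ) : longStepMass θ M ≤ 1 :=
  ENNReal.toReal_le_of_le_ofReal one_pos.le (by simp)

theorem ofReal_longStepMass_le (θ M : ℝ) : ENNReal.ofReal (longStepMass θ M) ≤
    ∫⁻ u in longNarrowSteps θ M, expNeg (volume (Metric.ball (0 : ℂ) ‖u‖)) := by
  rw [longStepMass, ENNReal.ofReal_toReal ((min_le_left _ _).trans_lt ENNReal.one_lt_top).ne]
  exact min_le_right _ _

/-- An upper bound for the exponential moment of the length of a step. -/
noncomputable def stepMoment (θ : ℝ) : ℝ≥0∞ :=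
  ∫⁻ u : ℂ, ENNReal.ofReal (Real.exp ‖u‖) *
    expNeg (volume (narrowCone θ 0 ∩ Metric.ball (0 : ℂ) ‖u‖))

/-- The narrow cone contains a ball of radius proportional to |u| within distance |u|, so the
integrand has a Gaussian bound. -/
theorem stepMoment_lt_top (hθ : θ ∈ Set.Ioo 0 (Real.pi / 2)) : stepMoment θ < ∞ := by
  obtain ⟨δ, hδ, h⟩ := exists_ball_subset_narrowCone hθ
  set c : ℝ := δ ^ 2 with hc
  have hcpos : 0 < c := by positivity
  have hint : Integrable (fun u : ℂ => Real.exp (1 / (2 * c)) * Real.exp (-(c / 2) * ‖u‖ ^ 2)) := by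
    refine Integrable.const_mul ?_ _
    have := (GaussianFourier.integrable_cexp_neg_mul_sq_norm_add (b := ((c / 2 : ℝ) : ℂ)) (V := ℂ)
      (by rw [Complex.ofReal_re]; positivity) 0 0).norm
    refine this.congr (Filter.Eventually.of_forall fun u => ?_)
    simp only [Complex.norm_exp, zero_mul, add_zero]
    congr 1
    rw [← Complex.ofReal_pow, ← Complex.ofReal_neg, ← Complex.ofReal_mul, Complex.ofReal_re]
  refine lt_of_le_of_lt (lintegral_mono fun u => ?_) hint.lintegral_lt_top
  have hvol : ENNReal.ofReal (c * ‖u‖ ^ 2) ≤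
      volume (narrowCone θ 0 ∩ Metric.ball (0 : ℂ) ‖u‖) := by
    refine le_trans ?_ (measure_mono (h 0 ‖u‖ (norm_nonneg u)))
    rw [Complex.volume_ball, ← ENNReal.ofReal_pow (by positivity), mul_pow, ← hc]
    refine le_mul_of_one_le_right zero_le ?_
    have : (1 : ℝ≥0) ≤ NNReal.pi := by
      rw [← NNReal.coe_le_coe]
      simpa using (by linarith [Real.pi_gt_three] : (1 : ℝ) ≤ Real.pi)
    exact_mod_cast this
  have hexp : expNeg (volume (narrowCone θ 0 ∩ Metric.ball (0 : ℂ) ‖u‖)) ≤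
      ENNReal.ofReal (Real.exp (-(c * ‖u‖ ^ 2))) := by
    refine (expNeg_antitone hvol).trans_eq ?_
    rw [expNeg_of_ne_top ENNReal.ofReal_ne_top, ENNReal.toReal_ofReal (by positivity)]
  refine (mul_le_mul_right hexp _).trans ?_
  rw [← ENNReal.ofReal_mul (Real.exp_pos _).le, ← Real.exp_add, ← Real.exp_add]
  refine ENNReal.ofReal_le_ofReal (Real.exp_le_exp.2 ?_)
  -- Completing the square absorbs the linear term at the price of half of the Gaussian exponent.
  have hsq : 1 / (2 * c) + -(c / 2) * ‖u‖ ^ 2 - (‖u‖ + -(c * ‖u‖ ^ 2)) =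
      (c * ‖u‖ - 1) ^ 2 / (2 * c) := by
    field_simp
    ring
  have : 0 ≤ (c * ‖u‖ - 1) ^ 2 / (2 * c) := by positivity
  linarith

/-- The law of the next point after `x` if there is no point in the explored region `E`. -/
noncomputable def stepLaw (θ : ℝ) (x : ℂ) (E : Set ℂ) : Measure ℂ :=
  (volume.restrict (cone θ x \ E)).withDensity fun y => expNeg (volume (explored θ x y \ E))

theorem measurable_stepLaw_density (hθ : θ ∈ Set.Ioo 0 (Real.pi / 2)) (x : ℂ) {E : Set ℂ}
    (hE : MeasurableSet E) : Measurable fun y => expNeg (volume (explored θ x y \ E)) := by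
  refine measurable_expNeg.comp ?_
  have h : MeasurableSet {p : ℂ × ℂ | p.2 ∈ explored θ x p.1} :=
    (measurableSet_explored_prod hθ).preimage (f := fun p : ℂ × ℂ => ((x, p.1), p.2)) (by fun_prop)
  exact measurable_measure_prodMk_left (h.diff (measurable_snd hE))

theorem expNeg_volume_union_explored (hθ : θ ∈ Set.Ioo 0 (Real.pi / 2)) (x y : ℂ) {E : Set ℂ}
    (hE : MeasurableSet E) : expNeg (volume (E ∪ explored θ x y)) =
      expNeg (volume E) * expNeg (volume (explored θ x y \ E)) := by
  rw [← expNeg_add, ← measure_union Set.disjoint_sdiff_right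
    ((measurableSet_explored hθ x y).diff hE), Set.union_sdiff_self]

theorem lintegral_stepLaw (hθ : θ ∈ Set.Ioo 0 (Real.pi / 2)) (x : ℂ) {E : Set ℂ}
    (hE : MeasurableSet E) {f : ℂ → ℝ≥0∞} (hf : Measurable f) :
    expNeg (volume E) * ∫⁻ y, f y ∂stepLaw θ x E =
      ∫⁻ y in cone θ x \ E, f y * expNeg (volume (E ∪ explored θ x y)) := by
  rw [stepLaw, lintegral_withDensity_eq_lintegral_mul _ (measurable_stepLaw_density hθ x hE) hf,
    ← lintegral_const_mul' _ _ (expNeg_ne_top _)]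
  refine lintegral_congr fun y => ?_
  rw [expNeg_volume_union_explored hθ x y hE, Pi.mul_apply]
  ring

/-- The total mass times the void probability of E is at most the sum of the one-step probabilities
with and without a renewal. The void probability cancels, being positive since E has finite area. -/
theorem stepLaw_univ_le (hθ : θ ∈ Set.Ioo 0 (Real.pi / 2)) (x : ℂ) {E : Set ℂ}
    (hE : MeasurableSet E) (hEv : volume E ≠ ∞)
    (hmass : pathProb θ 1 [true] x E + pathProb θ 1 [false] x E = expNeg (volume E)) :
    stepLaw θ x E Set.univ ≤ 1 := by
  classical
  have h0 := expNeg_ne_zero hEv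
  have h := lintegral_stepLaw hθ x hE (f := fun _ => 1) measurable_const
  rw [lintegral_one] at h
  refine (ENNReal.mul_le_mul_iff_right h0 (expNeg_ne_top _)).1 ?_
  have hR : MeasurableSet {y | volume (cone θ y ∩ (E ∪ explored θ x y)) = 0} :=
    ((measurable_volume_cone_inter hθ (α := Unit) (x := fun _ => x) measurable_const
      (E := Prod.snd ⁻¹' E) (measurable_snd hE)).comp (measurable_prodMk_left (x := ())))
      (measurableSet_singleton 0)
  have hCE := (measurableSet_cone hθ x).diff hE
  rw [h, mul_one, ← hmass, pathProb, pathProb, ENNReal.coe_one, one_mul, one_mul,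
    ← lintegral_inter_add_sdiff _ _ hR, ← lintegral_indicator (hCE.inter hR),
    ← lintegral_indicator (hCE.diff hR)]
  refine add_le_add (lintegral_mono fun y => ?_) (lintegral_mono fun y => ?_)
  · by_cases hy : y ∈ (cone θ x \ E) ∩ {y | volume (cone θ y ∩ (E ∪ explored θ x y)) = 0}
    swap
    · rw [Set.indicator_of_notMem hy]
      exact zero_le
    rw [Set.indicator_of_mem hy]
    have hy2 : volume (cone θ y ∩ (E ∪ explored θ x y)) = 0 := hy.2
    simp only [hy.1.1, hy.1.2, hy2, pathProb]
    simp
  · by_cases hy : y ∈ (cone θ x \ E) \ {y | volume (cone θ y ∩ (E ∪ explored θ x y)) = 0}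
    swap
    · rw [Set.indicator_of_notMem hy]
      exact zero_le
    rw [Set.indicator_of_mem hy]
    have hy2 : ¬ volume (cone θ y ∩ (E ∪ explored θ x y)) = 0 := hy.2
    simp only [hy.1.1, hy.1.2, hy2, pathProb]
    simp

/-- The newly explored region contains the part of the narrow cone within distance |y - x|, which E
does not touch. This bounds the density uniformly in the history. -/
theorem norm_stepLaw_le (hθ : θ ∈ Set.Ioo 0 (Real.pi / 2)) {x : ℂ} {E : Set ℂ}
    (hE : MeasurableSet E) (hdisj : Disjoint (narrowCone θ x) E) :
    ∫⁻ y, ENNReal.ofReal (Real.exp ‖y - x‖) ∂stepLaw θ x E ≤ stepMoment θ := by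
  have hm : Measurable fun y : ℂ => ENNReal.ofReal (Real.exp ‖y - x‖) := by fun_prop
  rw [stepLaw, lintegral_withDensity_eq_lintegral_mul _ (measurable_stepLaw_density hθ x hE) hm,
    stepMoment, ← lintegral_sub_right_eq_self (fun u : ℂ => ENNReal.ofReal (Real.exp ‖u‖) *
      expNeg (volume (narrowCone θ 0 ∩ Metric.ball (0 : ℂ) ‖u‖))) x]
  refine (setLIntegral_le_lintegral _ _).trans (lintegral_mono fun y => ?_)
  rw [Pi.mul_apply, mul_comm]
  refine mul_le_mul_right (expNeg_antitone ?_) _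
  have hpre : (fun w => w - x) ⁻¹' (narrowCone θ 0 ∩ Metric.ball (0 : ℂ) ‖y - x‖) =
      narrowCone θ x ∩ Metric.ball x ‖y - x‖ := by
    ext w
    simp [narrowCone, dist_eq_norm]
  rw [← volume_preimage_sub x (_ ∩ _), hpre]
  refine measure_mono fun w hw => ⟨⟨narrowCone_subset_cone hθ x hw.1, hw.2⟩, ?_⟩
  exact Set.disjoint_left.1 hdisj hw.1

/-- Long narrow steps end outside E, and their density is at least the void probability of the full
ball, whatever the history. -/
theorem longStepMass_le_stepLaw (hθ : θ ∈ Set.Ioo 0 (Real.pi / 2)) {x : ℂ} {E : Set ℂ}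
    (hdisj : Disjoint (narrowCone θ x) E) (M : ℝ) :
    ENNReal.ofReal (longStepMass θ M) ≤
      stepLaw θ x E ((fun y => y - x) ⁻¹' longNarrowSteps θ M) := by
  have hms : MeasurableSet ((fun y => y - x) ⁻¹' longNarrowSteps θ M) :=
    (measurableSet_longNarrowSteps θ M).preimage (by fun_prop)
  have hsub : (fun y => y - x) ⁻¹' longNarrowSteps θ M ⊆ cone θ x \ E := by
    intro y hy
    have hyn : y ∈ narrowCone θ x := by simpa [narrowCone] using hy.1
    exact ⟨narrowCone_subset_cone hθ x hyn, Set.disjoint_left.1 hdisj hyn⟩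
  refine (ofReal_longStepMass_le θ M).trans ?_
  rw [stepLaw, withDensity_apply _ hms, Measure.restrict_restrict hms,
    Set.inter_eq_left.2 hsub, ← lintegral_indicator (measurableSet_longNarrowSteps θ M),
    ← lintegral_sub_right_eq_self _ x, ← lintegral_indicator hms]
  refine lintegral_mono fun y => ?_
  by_cases hy : y - x ∈ longNarrowSteps θ M
  · rw [Set.indicator_of_mem hy, Set.indicator_of_mem
      (show y ∈ (fun y => y - x) ⁻¹' longNarrowSteps θ M from hy)]
    refine expNeg_antitone ?_
    have hpre : (fun w => w - x) ⁻¹' (Metric.ball (0 : ℂ) ‖y - x‖) = Metric.ball x ‖y - x‖ := by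
      ext w
      simp [dist_eq_norm]
    rw [← volume_preimage_sub x (Metric.ball (0 : ℂ) ‖y - x‖), hpre]
    exact measure_mono (Set.sdiff_subset.trans Set.inter_subset_right)
  · rw [Set.indicator_of_notMem hy]
    exact zero_le

end Tail

/-! ### Lyapunov estimate for the number of steps without renewal -/

section TailBound

variable {θ : ℝ}

/-- The factor by which the exponential of the extent of the history shrinks on average. -/
noncomputable def shrinkFactor (θ : ℝ) : ℝ := 1 - (1 - Real.exp (-1)) * longStepMass θ 1

theorem shrinkFactor_nonneg (θ : ℝ) : 0 ≤ shrinkFactor θ := by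
  have h1 := longStepMass_le_one θ 1
  have h2 := Real.exp_pos (-1)
  have h3 : Real.exp (-1) ≤ 1 := Real.exp_le_one_iff.2 (by norm_num)
  rw [shrinkFactor]
  nlinarith

theorem shrinkFactor_lt_one (hθ : θ ∈ Set.Ioo 0 (Real.pi / 2)) : shrinkFactor θ < 1 := by
  have h1 := longStepMass_pos hθ 1
  have h3 : Real.exp (-1) < 1 := by rw [← Real.exp_zero]; exact Real.exp_lt_exp.2 (by norm_num)
  rw [shrinkFactor]
  nlinarith

theorem measure_compl_le_of_le {ν : Measure ℂ} (hν : ν Set.univ ≤ 1) {N : Set ℂ}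
    (hN : MeasurableSet N) {q : ℝ} (hq : ENNReal.ofReal q ≤ ν N) :
    ν Nᶜ ≤ ENNReal.ofReal (1 - q) := by
  have hfin : ν Nᶜ ≠ ∞ := ((measure_mono (Set.subset_univ _)).trans_lt
    (hν.trans_lt ENNReal.one_lt_top)).ne
  have hadd := measure_add_measure_compl (μ := ν) hN
  have h1 : ENNReal.ofReal q + ν Nᶜ ≤ 1 := (add_le_add_left hq _).trans (hadd.trans_le hν)
  rw [← ENNReal.ofReal_toReal hfin]
  refine ENNReal.ofReal_le_ofReal ?_
  by_cases hq0 : 0 ≤ q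
  · rw [← ENNReal.ofReal_toReal hfin, ← ENNReal.ofReal_add hq0 ENNReal.toReal_nonneg,
      ENNReal.ofReal_le_one] at h1
    linarith
  · have : (ν Nᶜ).toReal ≤ 1 := ENNReal.toReal_le_of_le_ofReal one_pos.le
      (by simpa using le_trans le_add_self h1)
    linarith

/-- The mean of `exp (- Re u)` for the step `u`. -/
theorem lintegral_exp_neg_re_stepLaw_le (hθ : θ ∈ Set.Ioo 0 (Real.pi / 2)) {x : ℂ} {E : Set ℂ}
    (hdisj : Disjoint (narrowCone θ x) E) (hν : stepLaw θ x E Set.univ ≤ 1)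
    (hpos : ∀ᵐ y ∂stepLaw θ x E, 0 < (y - x).re) :
    ∫⁻ y, ENNReal.ofReal (Real.exp (-(y - x).re)) ∂stepLaw θ x E ≤
      ENNReal.ofReal (shrinkFactor θ) := by
  set ν := stepLaw θ x E
  set N : Set ℂ := (fun y => y - x) ⁻¹' longNarrowSteps θ 1 with hN
  have hNm : MeasurableSet N := (measurableSet_longNarrowSteps θ 1).preimage (by fun_prop)
  have hq : ENNReal.ofReal (longStepMass θ 1) ≤ ν N := longStepMass_le_stepLaw hθ hdisj 1
  have hc := measure_compl_le_of_le hν hNm hq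
  have hfinN : ν N ≠ ∞ := ((measure_mono (Set.subset_univ _)).trans_lt
    (hν.trans_lt ENNReal.one_lt_top)).ne
  have hfinC : ν Nᶜ ≠ ∞ := ((measure_mono (Set.subset_univ _)).trans_lt
    (hν.trans_lt ENNReal.one_lt_top)).ne
  -- Steps in N go at least 1 to the right and contribute a factor at most exp(-1); the other steps
  -- contribute at most 1.
  calc ∫⁻ y, ENNReal.ofReal (Real.exp (-(y - x).re)) ∂ν
      = ∫⁻ y in N, ENNReal.ofReal (Real.exp (-(y - x).re)) ∂ν +
        ∫⁻ y in Nᶜ, ENNReal.ofReal (Real.exp (-(y - x).re)) ∂ν :=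
        (lintegral_add_compl _ hNm).symm
    _ ≤ ∫⁻ _ in N, ENNReal.ofReal (Real.exp (-1)) ∂ν + ∫⁻ _ in Nᶜ, 1 ∂ν := by
        refine add_le_add ?_ ?_
        · refine setLIntegral_mono measurable_const fun y hy => ?_
          exact ENNReal.ofReal_le_ofReal (Real.exp_le_exp.2 (neg_le_neg hy.2))
        · refine lintegral_mono_ae (ae_restrict_of_ae ?_)
          filter_upwards [hpos] with y hy
          rw [ENNReal.ofReal_le_one, Real.exp_le_one_iff]
          linarith
    _ = ENNReal.ofReal (Real.exp (-1)) * ν N + ν Nᶜ := by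
        rw [setLIntegral_const, setLIntegral_const, one_mul]
    _ ≤ _ := by
        have hadd := measure_add_measure_compl (μ := ν) hNm
        rw [← hadd] at hν
        rw [← ENNReal.ofReal_toReal hfinN, ← ENNReal.ofReal_toReal hfinC] at hν ⊢
        rw [← ENNReal.ofReal_add ENNReal.toReal_nonneg ENNReal.toReal_nonneg,
          ENNReal.ofReal_le_one] at hν
        have hq' := ENNReal.toReal_mono hfinN hq
        rw [ENNReal.toReal_ofReal (longStepMass_pos hθ 1).le] at hq'
        rw [← ENNReal.ofReal_mul (Real.exp_pos _).le, ← ENNReal.ofReal_add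
          (mul_nonneg (Real.exp_pos _).le ENNReal.toReal_nonneg) ENNReal.toReal_nonneg]
        refine ENNReal.ofReal_le_ofReal ?_
        have h3 : Real.exp (-1) < 1 := by rw [← Real.exp_zero]; exact Real.exp_lt_exp.2 (by norm_num)
        rw [shrinkFactor]
        nlinarith

/-- The history after a step that is not a renewal. -/
theorem history_extent_step (hθ : θ ∈ Set.Ioo 0 (Real.pi / 2)) {x y : ℂ} {E : Set ℂ} {L : ℝ}
    (hL : 0 ≤ L) (hext : ∀ w ∈ E ∩ cone θ x, w.re < x.re + L) (hy : y ∈ cone θ x)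
    (hne : (cone θ y ∩ (E ∪ explored θ x y)).Nonempty) :
    y ∉ (fun y => y - x) ⁻¹' longNarrowSteps θ L ∧ ∃ L' : ℝ, 0 ≤ L' ∧
      (∀ w ∈ (E ∪ explored θ x y) ∩ cone θ y, w.re < y.re + L') ∧
      Real.exp L' ≤ Real.exp L * Real.exp (-(y - x).re) + Real.exp ‖y - x‖ := by
  classical
  have hsub := cone_subset_cone hθ hy
  have hre : 0 < (y - x).re := ((mem_cone_iff hθ).1 hy).1
  -- After a step into the narrow cone, the new ball does not meet the cone at y, so the newly
  -- explored region adds no extent. Otherwise it reaches less than |y - x| to the right of x.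
  set r : ℝ := if y ∈ narrowCone θ x then 0 else ‖y - x‖ with hr
  set L' : ℝ := max L r - (y - x).re with hL'
  have hbound : ∀ w ∈ (E ∪ explored θ x y) ∩ cone θ y, w.re < y.re + L' := by
    rintro w ⟨hw | hw, hwy⟩
    · have := hext w ⟨hw, hsub hwy⟩
      have h2 := le_max_left L r
      rw [hL', Complex.sub_re]
      linarith
    · have hwr := hw.2
      rw [Metric.mem_ball, dist_eq_norm] at hwr
      have hnn : y ∉ narrowCone θ x := fun h =>
        absurd (norm_sub_le_of_cone_narrowCone hθ (Or.inr ⟨h, hwy⟩)) (not_le.2 hwr)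
      have h3 := Complex.re_le_norm (w - x)
      rw [Complex.sub_re] at h3
      have h4 : ‖y - x‖ ≤ max L r := by
        rw [hr, if_neg hnn]
        exact le_max_right _ _
      rw [hL', Complex.sub_re]
      linarith
  have hL'pos : 0 < L' := by
    obtain ⟨w, hwy, hw⟩ := hne
    have h1 := hbound w ⟨hw, hwy⟩
    have h2 := ((mem_cone_iff hθ).1 hwy).1
    rw [Complex.sub_re] at h2
    linarith
  refine ⟨?_, L', hL'pos.le, hbound, ?_⟩
  -- A narrow step of advance at least L would give L' = L - Re(y - x) ≤ 0, but a nonempty history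
  -- has positive extent.
  · rintro ⟨hn, hLr⟩
    have hn' : y ∈ narrowCone θ x := by simpa [narrowCone] using hn
    rw [hL', hr, if_pos hn', max_eq_left hL] at hL'pos
    linarith
  · rw [hL', ← Real.exp_add]
    have hn := Real.exp_pos (L + -(y - x).re)
    have hp := Real.exp_pos ‖y - x‖
    rcases max_cases L r with ⟨h, -⟩ | ⟨h, hlt⟩
    · rw [h, sub_eq_add_neg]
      linarith
    · have : r - (y - x).re ≤ ‖y - x‖ := by
        have : r ≤ ‖y - x‖ := by
          rw [hr]
          split_ifs
          · exact norm_nonneg _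
          · exact le_rfl
        linarith
      rw [h]
      linarith [Real.exp_le_exp.2 this]

/-- The probability that there are `n` steps without a renewal is exponentially small. -/
theorem exists_tail_bound (hθ : θ ∈ Set.Ioo 0 (Real.pi / 2)) :
    ∃ ρ B : ℝ, 0 < ρ ∧ ρ < 1 ∧ 0 < B ∧
      ((∀ (x : ℂ) (E : Set ℂ), MeasurableSet E →
        pathProb θ 1 [true] x E + pathProb θ 1 [false] x E = expNeg (volume E)) →
      ∀ n : ℕ, pathProb θ 1 (List.replicate n false) 0 ∅ ≤ ENNReal.ofReal (B * ρ ^ n)) := by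
  classical
  obtain ⟨ρ, A, hρ0, hρ1, hA, hlyap⟩ := exists_lyapunov_constants
    (K := (stepMoment θ).toReal) ENNReal.toReal_nonneg (shrinkFactor_lt_one hθ)
    (shrinkFactor_nonneg θ) (longStepMass_antitone θ) (longStepMass_pos hθ)
  -- The constants are fixed before the mass identity is assumed, so they depend on θ only.
  refine ⟨ρ, A + 1, hρ0, hρ1, by linarith, fun hmass n => ?_⟩
  -- The Lyapunov bound for an arbitrary history of extent at most L. The factor for E is there
  -- because `pathProb` includes the void probability of E.
  have key : ∀ (n : ℕ) (x : ℂ) (E : Set ℂ) (L : ℝ), MeasurableSet E → volume E ≠ ∞ →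
      IsHistory θ x E → x ∉ E → 0 ≤ L → (∀ w ∈ E ∩ cone θ x, w.re < x.re + L) →
      pathProb θ 1 (List.replicate n false) x E ≤
        ENNReal.ofReal (ρ ^ n * (A + Real.exp L)) * expNeg (volume E) := by
    intro n
    induction n with
    | zero =>
      intro x E L hE hEv hH hx hL hext
      rw [List.replicate_zero, pathProb, ENNReal.coe_one, one_mul]
      refine le_mul_of_one_le_left zero_le ?_
      rw [ENNReal.one_le_ofReal, pow_zero, one_mul]
      linarith [Real.exp_pos L]
    | succ n ih =>
      intro x E L hE hEv hH hx hL hext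
      have hdisj := hH.disjoint_narrowCone hθ hx
      have hν := stepLaw_univ_le hθ x hE hEv (hmass x E hE)
      have hCE := (measurableSet_cone hθ x).diff hE
      have hpos : ∀ᵐ y ∂stepLaw θ x E, 0 < (y - x).re := by
        refine (withDensity_absolutelyContinuous _ _).ae_le ?_
        filter_upwards [ae_restrict_mem hCE] with y hy
        exact ((mem_cone_iff hθ).1 hy.1).1
      set N : Set ℂ := (fun y => y - x) ⁻¹' longNarrowSteps θ L with hN
      have hNm : MeasurableSet N := (measurableSet_longNarrowSteps θ L).preimage (by fun_prop)
      -- F dominates A + exp L' at the next point y if there is no renewal at y; the term A is then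
      -- charged only off N, since steps in N are renewals.
      set F : ℂ → ℝ≥0∞ := fun y => Nᶜ.indicator (fun _ => ENNReal.ofReal A) y +
        (ENNReal.ofReal (Real.exp L) * ENNReal.ofReal (Real.exp (-(y - x).re)) +
          ENNReal.ofReal (Real.exp ‖y - x‖)) with hF
      have hF1 : Measurable (Nᶜ.indicator fun _ : ℂ => ENNReal.ofReal A) :=
        measurable_const.indicator hNm.compl
      have hFm : Measurable F := by
        refine hF1.add ?_
        fun_prop
      have hFint : ∫⁻ y, F y ∂stepLaw θ x E ≤ ENNReal.ofReal (ρ * (A + Real.exp L)) := by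
        rw [hF, lintegral_add_left hF1, lintegral_indicator_const hNm.compl,
          lintegral_add_left (by fun_prop), lintegral_const_mul' _ _ ENNReal.ofReal_ne_top]
        have h1 := measure_compl_le_of_le hν hNm (longStepMass_le_stepLaw hθ hdisj L)
        have h2 := lintegral_exp_neg_re_stepLaw_le hθ hdisj hν hpos
        have h3 := norm_stepLaw_le hθ hE hdisj
        rw [← ENNReal.ofReal_toReal (stepMoment_lt_top hθ).ne] at h3
        refine (add_le_add (mul_le_mul_right h1 _)
          (add_le_add (mul_le_mul_right h2 _) h3)).trans ?_
        have hq := longStepMass_le_one θ L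
        have hs := shrinkFactor_nonneg θ
        rw [← ENNReal.ofReal_mul (by linarith), ← ENNReal.ofReal_mul (Real.exp_pos _).le,
          ← ENNReal.ofReal_add (by positivity) ENNReal.toReal_nonneg,
          ← ENNReal.ofReal_add (mul_nonneg (by linarith) (by linarith)) (by positivity)]
        refine ENNReal.ofReal_le_ofReal ?_
        rw [← add_assoc]
        exact hlyap L
      calc pathProb θ 1 (List.replicate (n + 1) false) x E
          ≤ ∫⁻ y in cone θ x \ E, ENNReal.ofReal (ρ ^ n) *
              (F y * expNeg (volume (E ∪ explored θ x y))) := by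
            rw [List.replicate_succ, pathProb, ENNReal.coe_one, one_mul,
              ← lintegral_indicator hCE]
            refine lintegral_mono fun y => ?_
            by_cases hy : y ∈ cone θ x ∧ y ∉ E ∧
              (volume (cone θ y ∩ (E ∪ explored θ x y)) = 0 ↔ false = true)
            · rw [if_pos hy]
              obtain ⟨hyx, hyE, hr⟩ := hy
              have hne : (cone θ y ∩ (E ∪ explored θ x y)).Nonempty := by
                rw [Set.nonempty_iff_ne_empty]
                intro h
                rw [h, measure_empty] at hr
                simp at hr
              obtain ⟨hyN, L', hL', hext', hexp⟩ := history_extent_step hθ hL hext hyx hne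
              rw [Set.indicator_of_mem (show y ∈ cone θ x \ E from ⟨hyx, hyE⟩)]
              have hv : volume (E ∪ explored θ x y) ≠ ∞ :=
                measure_union_ne_top hEv (volume_explored_ne_top θ x y)
              have hyE' : y ∉ E ∪ explored θ x y := by
                rintro (h | h)
                · exact hyE h
                · exact notMem_explored_self θ x y h
              refine (ih y _ L' (hE.union (measurableSet_explored hθ x y)) hv
                (hH.union_explored hθ hyx) hyE' hL' hext').trans ?_
              rw [← mul_assoc, ENNReal.ofReal_mul (by positivity)]
              refine mul_le_mul_left (mul_le_mul_right ?_ _) _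
              rw [hF]
              dsimp only
              rw [Set.indicator_of_mem (show y ∈ Nᶜ from hyN),
                ← ENNReal.ofReal_mul (Real.exp_pos _).le,
                ← ENNReal.ofReal_add (by positivity) (by positivity),
                ← ENNReal.ofReal_add (by positivity) (by positivity)]
              exact ENNReal.ofReal_le_ofReal (by linarith)
            · rw [if_neg hy]
              exact zero_le
        _ = ENNReal.ofReal (ρ ^ n) * (expNeg (volume E) * ∫⁻ y, F y ∂stepLaw θ x E) := by
            rw [lintegral_const_mul' _ _ ENNReal.ofReal_ne_top, lintegral_stepLaw hθ x hE hFm]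
        _ ≤ ENNReal.ofReal (ρ ^ n) * (expNeg (volume E) *
              ENNReal.ofReal (ρ * (A + Real.exp L))) :=
            mul_le_mul_right (mul_le_mul_right hFint _) _
        _ = ENNReal.ofReal (ρ ^ (n + 1) * (A + Real.exp L)) * expNeg (volume E) := by
            rw [mul_comm (expNeg _), ← mul_assoc, ← ENNReal.ofReal_mul (by positivity), pow_succ,
              mul_assoc]
  -- The path starts with empty history and extent 0, where A + exp 0 is the constant A + 1.
  have h := key n 0 ∅ 0 MeasurableSet.empty (by simp) (isHistory_empty θ 0) (by simp) le_rfl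
    (by simp)
  rwa [Real.exp_zero, measure_empty, expNeg_zero, mul_one, mul_comm] at h

end TailBound

/-! ### Deterministic renewal times and gaps -/

section RenewalSequences

/-- The renewal times of a sequence of events. -/
noncomputable def renewalTime (p : ℕ → Prop) : ℕ → ℕ∞
  | 0 => 0
  | k + 1 => sInf {t : ℕ∞ | ∃ n : ℕ, t = n ∧ renewalTime p k < n ∧ p n}

/-- The gaps between the renewal times of a sequence of events. -/
noncomputable def renewalGap (p : ℕ → Prop) (k : ℕ) : ℕ∞ :=
  renewalTime p (k + 1) - renewalTime p k

theorem tau_eq_renewalTime (θ : ℝ) (S : Set ℂ) (k : ℕ) :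
    tau θ S k = renewalTime (fun n => history θ S n = ∅) k := by
  induction k with
  | zero => rfl
  | succ k ih => rw [tau, renewalTime, ih]

theorem gap_eq_renewalGap (θ : ℝ) (S : Set ℂ) (k : ℕ) :
    gap θ S k = renewalGap (fun n => history θ S n = ∅) k := by
  rw [gap, renewalGap, tau_eq_renewalTime, tau_eq_renewalTime]

variable {p : ℕ → Prop}

theorem renewalTime_succ_le {k n : ℕ} (h : renewalTime p k < n) (hn : p n) :
    renewalTime p (k + 1) ≤ n := sInf_le ⟨n, rfl, h, hn⟩

theorem renewalTime_succ_eq_coe_iff {k m : ℕ} : renewalTime p (k + 1) = m ↔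
    renewalTime p k < m ∧ p m ∧ ∀ j < m, ¬ (renewalTime p k < j ∧ p j) := by
  constructor
  · intro h
    have hmin : ∀ j < m, ¬ (renewalTime p k < j ∧ p j) := by
      rintro j hj ⟨h1, h2⟩
      have := renewalTime_succ_le h1 h2
      rw [h] at this
      exact absurd (by exact_mod_cast this) (not_le.2 hj)
    rw [renewalTime] at h
    have hne : {t : ℕ∞ | ∃ n : ℕ, t = n ∧ renewalTime p k < n ∧ p n}.Nonempty := by
      rw [Set.nonempty_iff_ne_empty]
      intro he
      rw [he, sInf_empty] at h
      exact ENat.natCast_ne_top m h.symm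
    have hmem := csInf_mem hne
    rw [h] at hmem
    obtain ⟨n, hn, h1, h2⟩ := hmem
    have hmn : m = n := by exact_mod_cast hn
    subst hmn
    exact ⟨h1, h2, hmin⟩
  · rintro ⟨h1, h2, h3⟩
    refine le_antisymm (renewalTime_succ_le h1 h2) (le_sInf ?_)
    rintro _ ⟨n, rfl, h4, h5⟩
    by_contra hlt
    rw [not_le] at hlt
    exact h3 n (by exact_mod_cast hlt) ⟨h4, h5⟩

theorem renewalTime_succ_eq_add_iff {k t a : ℕ} (ht : renewalTime p k = t) :
    renewalTime p (k + 1) = ((t + (a + 1) : ℕ) : ℕ∞) ↔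
      (∀ j < a, ¬ p (t + 1 + j)) ∧ p (t + 1 + a) := by
  rw [renewalTime_succ_eq_coe_iff, ht, show t + (a + 1) = t + 1 + a by ring]
  simp only [Nat.cast_lt]
  constructor
  · rintro ⟨-, h2, h3⟩
    exact ⟨fun j hj hp => h3 (t + 1 + j) (by omega) ⟨by omega, hp⟩, h2⟩
  · rintro ⟨h1, h2⟩
    refine ⟨by omega, h2, ?_⟩
    rintro j hj ⟨h3, h4⟩
    exact h1 (j - (t + 1)) (by omega) (by rwa [show t + 1 + (j - (t + 1)) = j by omega])

/-- Writing the gap as a + 1 matters: only a positive value of the truncated difference determines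
the next time. An infinite next time gives an infinite gap. -/
theorem renewalGap_eq_add_one_iff {k t a : ℕ} (ht : renewalTime p k = t) :
    renewalGap p k = ((a + 1 : ℕ) : ℕ∞) ↔
      renewalTime p (k + 1) = ((t + (a + 1) : ℕ) : ℕ∞) := by
  rw [renewalGap, ht]
  cases hk : renewalTime p (k + 1) with
  | top =>
    rw [ENat.top_sub_natCast]
    exact iff_of_false (ENat.natCast_ne_top _).symm (ENat.natCast_ne_top _).symm
  | coe s =>
    rw [← ENat.natCast_sub, Nat.cast_inj, Nat.cast_inj]
    omega

theorem matches_append (bs cs : List Bool) :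
    ∀ n, Matches p n (bs ++ cs) ↔ Matches p n bs ∧ Matches p (n + bs.length) cs := by
  induction bs with
  | nil => intro n; simp [Matches]
  | cons b bs ih =>
    intro n
    rw [List.cons_append, Matches, Matches, ih, List.length_cons,
      show n + 1 + bs.length = n + (bs.length + 1) by ring, and_assoc]

theorem matches_replicate_false (m : ℕ) :
    ∀ n, Matches p n (List.replicate m false) ↔ ∀ j < m, ¬ p (n + j) := by
  induction m with
  | zero => intro n; simp [Matches]
  | succ m ih =>
    intro n
    rw [List.replicate_succ, Matches, ih, Nat.forall_lt_succ_left]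
    simp only [Bool.false_eq_true, iff_false, add_zero]
    refine and_congr_right fun _ => forall₂_congr fun j _ => ?_
    rw [show n + 1 + j = n + (j + 1) by ring]

/-- The pattern of consecutive renewal gaps `a + 1`. -/
def gapPattern (as : List ℕ) : List Bool :=
  as.flatMap fun a => List.replicate a false ++ [true]

/-- A gap a + 1 is the word of a non-renewals followed by one renewal. Starting from a known finite
renewal time, prescribing consecutive gaps means prescribing the concatenated word. -/
theorem forall_renewalGap_iff (m : ℕ) : ∀ (k t : ℕ) (a : Fin m → ℕ), renewalTime p k = t →
    ((∀ i : Fin m, renewalGap p (k + i) = ((a i + 1 : ℕ) : ℕ∞)) ↔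
      Matches p (t + 1) (gapPattern (List.ofFn a))) := by
  induction m with
  | zero => intro k t a _; simp [gapPattern, Matches]
  | succ m ih =>
    intro k t a ht
    have e0 : renewalGap p k = ((a 0 + 1 : ℕ) : ℕ∞) ↔
        Matches p (t + 1) (List.replicate (a 0) false ++ [true]) := by
      rw [renewalGap_eq_add_one_iff ht, renewalTime_succ_eq_add_iff ht, matches_append,
        matches_replicate_false]
      simp [Matches]
    rw [List.ofFn_succ, Fin.forall_fin_succ, gapPattern, List.flatMap_cons, matches_append,
      Fin.val_zero, add_zero, ← e0]
    refine and_congr_right fun h0 => ?_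
    rw [renewalGap_eq_add_one_iff ht] at h0
    have := ih (k + 1) (t + (a 0 + 1)) (fun i => a i.succ) h0
    rw [List.length_append, List.length_replicate, List.length_singleton]
    simp only [Fin.val_succ, gapPattern] at this ⊢
    rw [show t + 1 + (a 0 + 1) = t + (a 0 + 1) + 1 by ring, ← this]
    refine forall_congr' fun i => ?_
    rw [show k + (i.val + 1) = k + 1 + i.val by ring]

theorem renewalTime_le_of_forall_gap {d : ℕ} (k : ℕ) (h : ∀ i < k, renewalGap p i ≤ d) :
    renewalTime p k ≤ ((k * d : ℕ) : ℕ∞) := by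
  induction k with
  | zero => simp [renewalTime]
  | succ k ih =>
    calc renewalTime p (k + 1) ≤ renewalTime p k + renewalGap p k := le_add_tsub
      _ ≤ ((k * d : ℕ) : ℕ∞) + d :=
          add_le_add (ih fun i hi => h i (by omega)) (h k (by omega))
      _ = (((k + 1) * d : ℕ) : ℕ∞) := by rw [← Nat.cast_add, add_mul, one_mul]

/-- Otherwise all k gaps are at most (n - 1)/k, rounded down, and they add up to at most n - 1. The
value (n - 1)/k + 1 is n/k rounded up. -/
theorem exists_le_gap_of_le_renewalTime {k n : ℕ} (hn : 1 ≤ n)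
    (h : (n : ℕ∞) ≤ renewalTime p k) :
    ∃ i < k, (((n - 1) / k + 1 : ℕ) : ℕ∞) ≤ renewalGap p i := by
  by_contra! hcon
  have hle : renewalTime p k ≤ ((k * ((n - 1) / k) : ℕ) : ℕ∞) := by
    refine renewalTime_le_of_forall_gap k fun i hi => ?_
    have := hcon i hi
    rw [Nat.cast_add, Nat.cast_one] at this
    exact Order.lt_add_one_iff_of_not_isMax (by simp) |>.1 this
  have h1 : n ≤ k * ((n - 1) / k) := by exact_mod_cast h.trans hle
  have h2 := Nat.mul_div_le (n - 1) k
  omega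

theorem renewalTime_of_infinitely_often (h : ∀ t, (t = 0 ∨ p t) → ∃ n, t < n ∧ p n) (k : ℕ) :
    ∃ t : ℕ, renewalTime p k = t ∧ (t = 0 ∨ p t) ∧ ∃ a : ℕ, renewalGap p k = ((a + 1 : ℕ) : ℕ∞) := by
  have hgap : ∀ (k t : ℕ), renewalTime p k = t → (t = 0 ∨ p t) →
      ∃ a : ℕ, renewalTime p (k + 1) = ((t + (a + 1) : ℕ) : ℕ∞) ∧ p (t + (a + 1)) := by
    intro k t ht hp
    classical
    have hex : ∃ a, p (t + 1 + a) := by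
      obtain ⟨n, hn, hpn⟩ := h t hp
      exact ⟨n - (t + 1), by rwa [show t + 1 + (n - (t + 1)) = n by omega]⟩
    refine ⟨Nat.find hex, ?_, ?_⟩
    · rw [renewalTime_succ_eq_add_iff ht]
      exact ⟨fun j hj => Nat.find_min hex hj, Nat.find_spec hex⟩
    · rw [show t + (Nat.find hex + 1) = t + 1 + Nat.find hex by ring]
      exact Nat.find_spec hex
  have hrt : ∃ t : ℕ, renewalTime p k = t ∧ (t = 0 ∨ p t) := by
    induction k with
    | zero => exact ⟨0, rfl, Or.inl rfl⟩
    | succ k ih =>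
      obtain ⟨t, ht, hp⟩ := ih
      obtain ⟨a, ha, hpa⟩ := hgap k t ht hp
      exact ⟨_, ha, Or.inr hpa⟩
  obtain ⟨t, ht, hp⟩ := hrt
  obtain ⟨a, ha, -⟩ := hgap k t ht hp
  exact ⟨t, ht, hp, a, (renewalGap_eq_add_one_iff ht).2 ha⟩

end RenewalSequences

/-! ### Independence and common law of the gaps -/

section RenewalProcess

variable {Ω : Type*} [MeasurableSpace Ω] {μ : Measure Ω} {X : ℕ → Ω → Prop}

theorem measurable_renewalTime (hX : ∀ n, MeasurableSet {ω | X n ω}) (k : ℕ) :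
    Measurable fun ω => renewalTime (fun n => X n ω) k := by
  induction k with
  | zero => exact measurable_const
  | succ k ih =>
    refine ENat.measurable_iff.2 fun m => ?_
    have hlt : ∀ j : ℕ, MeasurableSet {ω | renewalTime (fun n => X n ω) k < j} := fun j =>
      ih (MeasurableSet.of_discrete (s := Set.Iio (j : ℕ∞)))
    have : (fun ω => renewalTime (fun n => X n ω) (k + 1)) ⁻¹' {(m : ℕ∞)} =
        {ω | renewalTime (fun n => X n ω) k < m} ∩ ({ω | X m ω} ∩
          ⋂ j : ℕ, ⋂ _ : j < m, ({ω | renewalTime (fun n => X n ω) k < j} ∩ {ω | X j ω})ᶜ) := by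
      ext ω
      simp only [Set.mem_preimage, Set.mem_singleton_iff, renewalTime_succ_eq_coe_iff,
        Set.mem_inter_iff, Set.mem_ofPred_eq, Set.mem_iInter, Set.mem_compl_iff]
    rw [this]
    exact (hlt m).inter ((hX m).inter (MeasurableSet.iInter fun j => MeasurableSet.iInter fun _ =>
      ((hlt j).inter (hX j)).compl))

theorem measurable_renewalGap (hX : ∀ n, MeasurableSet {ω | X n ω}) (k : ℕ) :
    Measurable fun ω => renewalGap (fun n => X n ω) k :=
  (Measurable.of_discrete (f := fun q : ℕ∞ × ℕ∞ => q.1 - q.2)).comp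
    ((measurable_renewalTime hX (k + 1)).prodMk (measurable_renewalTime hX k))

variable {q : List Bool → ℝ≥0∞}

/-- A first gap of at least n + 1 means no renewal at the steps 1, …, n, so the exponent is one less
than the gap. -/
theorem measure_le_renewalGap_zero (hq : ∀ bs, μ {ω | Matches (fun n => X n ω) 1 bs} = q bs)
    (n : ℕ) : μ {ω | ((n + 1 : ℕ) : ℕ∞) ≤ renewalGap (fun n => X n ω) 0} ≤
      q (List.replicate n false) := by
  rw [← hq]
  refine measure_mono fun ω hω => (matches_replicate_false n 1).2 fun j hj hXj => ?_
  have hle := renewalTime_succ_le (p := fun n => X n ω) (k := 0) (n := 1 + j)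
    (by rw [renewalTime]; exact_mod_cast (by omega : 0 < 1 + j)) hXj
  have h2 : ((n + 1 : ℕ) : ℕ∞) ≤ renewalTime (fun n => X n ω) 1 := by
    have h3 : ((n + 1 : ℕ) : ℕ∞) ≤ renewalGap (fun n => X n ω) 0 := hω
    rwa [renewalGap, renewalTime, tsub_zero] at h3
  have h4 : n + 1 ≤ 1 + j := by exact_mod_cast h2.trans hle
  omega

/-- After the start or after a renewal, n further steps without renewal have at most the probability
of n such steps from the origin, which tends to 0. A renewal at step t is covered by the countably
many patterns that end with it. -/
theorem ae_infinitely_often [IsProbabilityMeasure μ]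
    (hq : ∀ bs, μ {ω | Matches (fun n => X n ω) 1 bs} = q bs)
    (hren : ∀ bs cs, q (bs ++ true :: cs) = q (bs ++ [true]) * q cs)
    (htail : Filter.Tendsto (fun n => q (List.replicate n false)) Filter.atTop (nhds 0)) :
    ∀ᵐ ω ∂μ, ∀ t, (t = 0 ∨ X t ω) → ∃ n, t < n ∧ X n ω := by
  have hq1 : ∀ bs, q bs ≤ 1 := fun bs => hq bs ▸ prob_le_one
  have h0 : μ {ω | ∀ n, 0 < n → ¬ X n ω} = 0 := by
    refine le_antisymm (ge_of_tendsto' htail fun n => ?_) zero_le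
    rw [← hq]
    refine measure_mono fun ω hω => (matches_replicate_false n 1).2 fun j _ => hω _ (by omega)
  have h1 : ∀ bs : List Bool, μ {ω | Matches (fun n => X n ω) 1 (bs ++ [true]) ∧
      ∀ n, bs.length + 1 < n → ¬ X n ω} = 0 := by
    intro bs
    refine le_antisymm (ge_of_tendsto' htail fun n => ?_) zero_le
    calc _ ≤ μ {ω | Matches (fun n => X n ω) 1 (bs ++ true :: List.replicate n false)} := by
          refine measure_mono fun ω hω => ?_
          have hsplit : bs ++ true :: List.replicate n false =
            (bs ++ [true]) ++ List.replicate n false := by simp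
          change Matches _ _ _
          rw [hsplit, matches_append, matches_replicate_false]
          refine ⟨hω.1, fun j _ => hω.2 _ ?_⟩
          rw [List.length_append, List.length_singleton]
          omega
      _ = q (bs ++ [true]) * q (List.replicate n false) := by rw [hq, hren]
      _ ≤ 1 * q (List.replicate n false) := mul_le_mul_left (hq1 _) _
      _ = _ := one_mul _
  filter_upwards [measure_eq_zero_iff_ae_notMem.1 h0,
    ae_all_iff.2 fun bs => measure_eq_zero_iff_ae_notMem.1 (h1 bs)] with ω hω0 hω1 t ht
  by_contra! hcon
  rcases Nat.eq_zero_or_pos t with rfl | hpos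
  · exact hω0 hcon
  · obtain ⟨bs, hlen, hbs⟩ := (exists_matches_append_true (fun n => X n ω) (t - 1) 1).2
      (by rw [show 1 + (t - 1) = t by omega]; exact ht.resolve_left (by omega))
    exact hω1 bs ⟨hbs, by rwa [hlen, show t - 1 + 1 = t by omega]⟩

theorem prob_gapPattern [IsProbabilityMeasure μ]
    (hq : ∀ bs, μ {ω | Matches (fun n => X n ω) 1 bs} = q bs)
    (hren : ∀ bs cs, q (bs ++ true :: cs) = q (bs ++ [true]) * q cs) (m : ℕ) :
    ∀ a : Fin m → ℕ, q (gapPattern (List.ofFn a)) =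
      ∏ i, q (List.replicate (a i) false ++ [true]) := by
  induction m with
  | zero =>
    intro a
    rw [← hq]
    simp [gapPattern, Matches]
  | succ m ih =>
    intro a
    rw [List.ofFn_succ, gapPattern, List.flatMap_cons, Fin.prod_univ_succ, ← ih]
    rw [List.append_assoc, List.singleton_append, hren]
    rfl

/-- Both laws live on a countable space, so comparing singletons suffices. Points with all
coordinates finite and positive correspond to gap patterns, whose probability factors; any other
point is null for both laws. -/
theorem map_renewalGap_eq_pi [IsProbabilityMeasure μ] (hX : ∀ n, MeasurableSet {ω | X n ω})
    (hq : ∀ bs, μ {ω | Matches (fun n => X n ω) 1 bs} = q bs)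
    (hren : ∀ bs cs, q (bs ++ true :: cs) = q (bs ++ [true]) * q cs)
    (htail : Filter.Tendsto (fun n => q (List.replicate n false)) Filter.atTop (nhds 0)) (m : ℕ) :
    μ.map (fun ω (i : Fin m) => renewalGap (fun n => X n ω) i) =
      Measure.pi fun _ => μ.map fun ω => renewalGap (fun n => X n ω) 0 := by
  have hm := measurable_renewalGap hX
  have hpm : Measurable fun ω (i : Fin m) => renewalGap (fun n => X n ω) i :=
    measurable_pi_lambda _ fun i => hm i
  have := Measure.isProbabilityMeasure_map (μ := μ) (hm 0).aemeasurable
  have hae := ae_infinitely_often hq hren htail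
  have hbad : ∀ (c : ℕ∞), (¬ ∃ a : ℕ, c = ((a + 1 : ℕ) : ℕ∞)) → ∀ k,
      μ {ω | renewalGap (fun n => X n ω) k = c} = 0 := by
    intro c hc k
    rw [measure_eq_zero_iff_ae_notMem]
    filter_upwards [hae] with ω hω hmem
    obtain ⟨-, -, -, a, ha⟩ := renewalTime_of_infinitely_often hω k
    exact hc ⟨a, (show renewalGap (fun n => X n ω) k = c from hmem).symm.trans ha⟩
  have hsing : ∀ a : ℕ, μ {ω | renewalGap (fun n => X n ω) 0 = ((a + 1 : ℕ) : ℕ∞)} =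
      q (List.replicate a false ++ [true]) := by
    intro a
    rw [← hq]
    congr 1
    ext ω
    have := forall_renewalGap_iff (p := fun n => X n ω) 1 0 0 (fun _ => a) rfl
    simpa [gapPattern] using this
  refine Measure.ext_of_singleton fun c => ?_
  rw [Measure.pi_singleton, Measure.map_apply hpm (measurableSet_singleton c)]
  simp only [Measure.map_apply (hm 0) (measurableSet_singleton _)]
  by_cases hc : ∀ i, ∃ a : ℕ, c i = ((a + 1 : ℕ) : ℕ∞)
  · choose a ha using hc
    have e1 : (fun ω (i : Fin m) => renewalGap (fun n => X n ω) i) ⁻¹' {c} =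
        {ω | Matches (fun n => X n ω) 1 (gapPattern (List.ofFn a))} := by
      ext ω
      have := forall_renewalGap_iff (p := fun n => X n ω) m 0 0 a rfl
      simp only [zero_add] at this
      rw [Set.mem_ofPred_eq, ← this, Set.mem_preimage, Set.mem_singleton_iff, funext_iff]
      exact forall_congr' fun i => by rw [ha i]
    rw [e1, hq, prob_gapPattern hq hren]
    refine Finset.prod_congr rfl fun i _ => ?_
    rw [← hsing, ha i]
    rfl
  · push Not at hc
    obtain ⟨i, hi⟩ := hc
    have hi' : ¬ ∃ a : ℕ, c i = ((a + 1 : ℕ) : ℕ∞) := fun ⟨a, ha⟩ => hi a ha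
    rw [Finset.prod_eq_zero (Finset.mem_univ i) (hbad _ hi' 0)]
    refine measure_mono_null (fun ω hω => ?_) (hbad _ hi' i)
    exact congrFun hω i

theorem map_renewalGap_eq [IsProbabilityMeasure μ] (hX : ∀ n, MeasurableSet {ω | X n ω})
    (hq : ∀ bs, μ {ω | Matches (fun n => X n ω) 1 bs} = q bs)
    (hren : ∀ bs cs, q (bs ++ true :: cs) = q (bs ++ [true]) * q cs)
    (htail : Filter.Tendsto (fun n => q (List.replicate n false)) Filter.atTop (nhds 0)) (k : ℕ) :
    μ.map (fun ω => renewalGap (fun n => X n ω) k) =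
      μ.map fun ω => renewalGap (fun n => X n ω) 0 := by
  have hm := measurable_renewalGap hX
  have hpm : Measurable fun ω (i : Fin (k + 1)) => renewalGap (fun n => X n ω) i :=
    measurable_pi_lambda _ fun i => hm i
  have := Measure.isProbabilityMeasure_map (μ := μ) (hm 0).aemeasurable
  have h := (measurePreserving_eval (fun _ : Fin (k + 1) =>
    μ.map fun ω => renewalGap (fun n => X n ω) 0) (Fin.last k)).map_eq
  rw [← map_renewalGap_eq_pi hX hq hren htail (k + 1),
    Measure.map_map (measurable_pi_apply _) hpm] at h
  exact h

/-- Independence concerns finite index sets, each of which lies in an initial segment, where the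
joint law is the product. -/
theorem iIndepFun_renewalGap [IsProbabilityMeasure μ] (hX : ∀ n, MeasurableSet {ω | X n ω})
    (hq : ∀ bs, μ {ω | Matches (fun n => X n ω) 1 bs} = q bs)
    (hren : ∀ bs cs, q (bs ++ true :: cs) = q (bs ++ [true]) * q cs)
    (htail : Filter.Tendsto (fun n => q (List.replicate n false)) Filter.atTop (nhds 0)) :
    iIndepFun (fun k ω => renewalGap (fun n => X n ω) k) μ := by
  have hm := measurable_renewalGap hX
  rw [iIndepFun_iff_finset]
  intro s
  obtain ⟨m, hs⟩ := s.exists_nat_subset_range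
  have hfin : iIndepFun (fun (i : Fin m) ω => renewalGap (fun n => X n ω) i) μ := by
    rw [iIndepFun_iff_map_fun_eq_pi_map fun i : Fin m => (hm i).aemeasurable,
      map_renewalGap_eq_pi hX hq hren htail m]
    congr 1
    ext1 i
    exact (map_renewalGap_eq hX hq hren htail i).symm
  have hg : Function.Injective fun i : s => (⟨i, Finset.mem_range.1 (hs i.2)⟩ : Fin m) := by
    intro i j hij
    exact Subtype.ext (Fin.mk.inj hij)
  exact iIndepFun.precomp (f := fun (i : Fin m) ω => renewalGap (fun n => X n ω) i) hg hfin

end RenewalProcess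

end DirectedNavigation

/-! ### The theorem -/

theorem proposition4p1 (θ : ℝ) (hθ0 : 0 < θ) (hθ : θ < Real.pi / 2) :
    ∃ c C : ℝ, 0 < c ∧ 0 < C ∧
      ∀ (lam : ℝ≥0), 0 < lam →
      ∀ (Ω : Type*) [MeasurableSpace Ω] (μ : Measure Ω) [IsProbabilityMeasure μ]
        (P : Ω → Set ℂ), DirectedNavigation.IsPoissonProcess μ lam P →
        -- all renewal steps are almost surely finite
        (∀ᵐ ω ∂μ, ∀ k : ℕ, DirectedNavigation.tau θ (P ω) k < ⊤) ∧
        -- the renewal gaps are independent and identically distributed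
        iIndepFun (fun (k : ℕ) (ω : Ω) => DirectedNavigation.gap θ (P ω) k) μ ∧
        (∀ k : ℕ, IdentDistrib (fun ω => DirectedNavigation.gap θ (P ω) k)
          (fun ω => DirectedNavigation.gap θ (P ω) 0) μ μ) ∧
        -- the gap `τ k - τ (k - 1)` has an exponential tail, and so has `τ k`
        (∀ k n : ℕ, 1 ≤ k →
          μ.real {ω | (n : ℕ∞) ≤ DirectedNavigation.tau θ (P ω) k
              - DirectedNavigation.tau θ (P ω) (k - 1)} ≤ C * Real.exp (-c * n)) ∧
        (∀ k n : ℕ, 1 ≤ k →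
          μ.real {ω | (n : ℕ∞) ≤ DirectedNavigation.tau θ (P ω) k}
            ≤ k * C * Real.exp (-c * n / k)) := by
  open DirectedNavigation in
  have hθ' : θ ∈ Set.Ioo 0 (Real.pi / 2) := ⟨hθ0, hθ⟩
  obtain ⟨ρ, B, hρ0, hρ1, hB, htail⟩ := exists_tail_bound hθ'
  have hc : 0 < -Real.log ρ := neg_pos.2 (Real.log_neg hρ0 hρ1)
  set c : ℝ := -Real.log ρ with hcdef
  -- The factor 1/ρ makes up for the shift by one between a gap and its number of steps without
  -- renewal; the bound C ≥ 1 covers n = 0.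
  set C : ℝ := max 1 (B / ρ) with hCdef
  have hC1 : 1 ≤ C := le_max_left _ _
  have hexp : ∀ n : ℕ, Real.exp (-c * n) = ρ ^ n := fun n => by
    rw [hcdef, neg_neg, mul_comm, ← Real.log_pow, Real.exp_log (pow_pos hρ0 n)]
  refine ⟨c, C, hc, by linarith, fun lam hlam Ω _ μ _ P hP => ?_⟩
  -- From here on the measurable versions X of the renewal events are used; the results pass to
  -- `tau` and `gap` almost surely.
  obtain ⟨X, hX, hXae, hq⟩ := measure_matches hθ' hlam hP
  have hQ := hP.isPoissonLaw hlam
  have hfin : ∀ bs, pathProb θ lam bs 0 ∅ ≠ ∞ := fun bs => hq bs ▸ measure_ne_top _ _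
  have hren : ∀ bs cs, pathProb θ lam (bs ++ true :: cs) 0 ∅ =
      pathProb θ lam (bs ++ [true]) 0 ∅ * pathProb θ lam cs 0 ∅ := fun bs cs =>
    pathProb_append_true_cons hθ' (hfin cs) bs 0 ∅ MeasurableSet.empty
  have hbound : ∀ n, pathProb θ lam (List.replicate n false) 0 ∅ ≤ ENNReal.ofReal (B * ρ ^ n) :=
    fun n => by
      rw [pathProb_scale hlam]
      exact htail (fun x E hE => pathProb_one_true_add_false hθ' hlam hQ x hE) n
  have hlim : Filter.Tendsto (fun n => pathProb θ lam (List.replicate n false) 0 ∅)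
      Filter.atTop (nhds 0) := by
    refine tendsto_of_tendsto_of_tendsto_of_le_of_le tendsto_const_nhds ?_
      (fun n => zero_le) hbound
    rw [← ENNReal.ofReal_zero, ← mul_zero B]
    exact ENNReal.tendsto_ofReal
      ((tendsto_pow_atTop_nhds_zero_of_lt_one hρ0.le hρ1).const_mul B)
  have hXeq : ∀ᵐ ω ∂μ, (fun n => history θ (P ω) n = ∅) = fun n => X n ω := by
    filter_upwards [hXae] with ω hω
    exact funext fun n => propext (hω n).symm
  have htau : ∀ᵐ ω ∂μ, ∀ k, tau θ (P ω) k = renewalTime (fun n => X n ω) k := by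
    filter_upwards [hXeq] with ω hω k
    rw [tau_eq_renewalTime, hω]
  have hgap : ∀ k, (fun ω => renewalGap (fun n => X n ω) k) =ᵐ[μ] fun ω => gap θ (P ω) k := by
    intro k
    filter_upwards [hXeq] with ω hω
    rw [gap_eq_renewalGap, hω]
  have hm := measurable_renewalGap hX
  have hgaptail : ∀ k n : ℕ, μ.real {ω | (n : ℕ∞) ≤ renewalGap (fun n => X n ω) k} ≤
      C * Real.exp (-c * n) := by
    intro k n
    have hlaw := map_renewalGap_eq hX hq hren hlim k
    have hset : MeasurableSet (Set.Ici (n : ℕ∞)) := MeasurableSet.of_discrete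
    have heq : μ {ω | (n : ℕ∞) ≤ renewalGap (fun n => X n ω) k} =
        μ {ω | (n : ℕ∞) ≤ renewalGap (fun n => X n ω) 0} := by
      have := congrArg (fun ν : Measure ℕ∞ => ν (Set.Ici (n : ℕ∞))) hlaw
      rwa [Measure.map_apply (hm k) hset, Measure.map_apply (hm 0) hset] at this
    rw [measureReal_def, heq, hexp]
    rcases n with _ | n
    · rw [pow_zero, mul_one]
      refine le_trans ?_ hC1
      exact ENNReal.toReal_le_of_le_ofReal one_pos.le (by simp)
    · refine ENNReal.toReal_le_of_le_ofReal (by positivity)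
        ((measure_le_renewalGap_zero hq n).trans ((hbound n).trans
          (ENNReal.ofReal_le_ofReal ?_)))
      calc B * ρ ^ n = B / ρ * ρ ^ (n + 1) := by rw [pow_succ]; field_simp
        _ ≤ C * ρ ^ (n + 1) := mul_le_mul_of_nonneg_right (le_max_right _ _) (by positivity)
  refine ⟨?_, ?_, ?_, ?_, ?_⟩
  · filter_upwards [htau, ae_infinitely_often hq hren hlim] with ω hω hinf k
    obtain ⟨t, ht, -⟩ := renewalTime_of_infinitely_often hinf k
    rw [hω, ht]
    exact ENat.natCast_lt_top t
  · exact (iIndepFun_renewalGap hX hq hren hlim).congr hgap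
  · intro k
    have h1 : IdentDistrib (fun ω => renewalGap (fun n => X n ω) k)
        (fun ω => renewalGap (fun n => X n ω) 0) μ μ :=
      ⟨(hm k).aemeasurable, (hm 0).aemeasurable, map_renewalGap_eq hX hq hren hlim k⟩
    exact ((IdentDistrib.of_ae_eq (hm k).aemeasurable (hgap k)).symm.trans h1).trans
      (IdentDistrib.of_ae_eq (hm 0).aemeasurable (hgap 0))
  · intro k n hk
    obtain ⟨k, rfl⟩ := Nat.exists_eq_add_of_le' hk
    refine le_trans (le_of_eq (measureReal_congr ?_)) (hgaptail k n)
    filter_upwards [htau] with ω hω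
    change ((n : ℕ∞) ≤ tau θ (P ω) (k + 1) - tau θ (P ω) (k + 1 - 1)) =
      ((n : ℕ∞) ≤ renewalGap (fun n => X n ω) k)
    rw [hω, hω, renewalGap, Nat.add_sub_cancel]
  · intro k n hk
    have hkpos : (0 : ℝ) < k := by exact_mod_cast hk
    have hkC : 1 ≤ (k : ℝ) * C := one_le_mul_of_one_le_of_one_le (by exact_mod_cast hk) hC1
    rcases Nat.eq_zero_or_pos n with rfl | hn
    · have h0 : Real.exp (-c * ((0 : ℕ) : ℝ) / k) = 1 := by simp
      rw [h0, mul_one]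
      exact measureReal_le_one.trans hkC
    have hcongr : μ.real {ω | (n : ℕ∞) ≤ tau θ (P ω) k} =
        μ.real {ω | (n : ℕ∞) ≤ renewalTime (fun n => X n ω) k} := by
      refine measureReal_congr ?_
      filter_upwards [htau] with ω hω
      change ((n : ℕ∞) ≤ tau θ (P ω) k) = ((n : ℕ∞) ≤ renewalTime (fun n => X n ω) k)
      rw [hω]
    -- d is n/k rounded up, so the tail of a gap at d is bounded by exp(-cn/k). The union bound over
    -- the k gaps gives the factor k.
    set d : ℕ := (n - 1) / k + 1 with hd
    have hdn : (n : ℝ) / k ≤ d := by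
      rw [div_le_iff₀ hkpos]
      have := Nat.lt_mul_div_succ (n - 1) hk
      have h2 : n ≤ d * k := by
        rw [hd, mul_comm]
        omega
      exact_mod_cast h2
    calc μ.real {ω | (n : ℕ∞) ≤ tau θ (P ω) k}
        ≤ μ.real (⋃ i ∈ Finset.range k, {ω | (d : ℕ∞) ≤ renewalGap (fun n => X n ω) i}) := by
          rw [hcongr]
          refine measureReal_mono (fun ω hω => ?_) (measure_ne_top _ _)
          obtain ⟨i, hi, h⟩ := exists_le_gap_of_le_renewalTime (p := fun n => X n ω) hn hω
          exact Set.mem_biUnion (Finset.mem_coe.2 (Finset.mem_range.2 hi)) h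
      _ ≤ ∑ i ∈ Finset.range k, μ.real {ω | (d : ℕ∞) ≤ renewalGap (fun n => X n ω) i} :=
          measureReal_biUnion_finset_le _ _
      _ ≤ ∑ _i ∈ Finset.range k, C * Real.exp (-c * d) :=
          Finset.sum_le_sum fun i _ => hgaptail i d
      _ = k * C * Real.exp (-c * d) := by
          rw [Finset.sum_const, Finset.card_range, nsmul_eq_mul, mul_assoc]
      _ ≤ k * C * Real.exp (-c * n / k) := by
          refine mul_le_mul_of_nonneg_left (Real.exp_le_exp.2 ?_) (by positivity)
          rw [mul_div_assoc]
          nlinarith
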